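/- Let $d\ge 1$, $m>0$ and $\gamma\in\big[0,\frac{d+1}{2}\big)$, let $|\cdot|$ be the Euclidean norm on $\mathbb R^d$, and let $f(x)=e^{-m|x|}g(|x|)$, $x\in\mathbb R^d$, where either $g(r)=r^{-\gamma}$ or $g(r)=(1\vee r)^{-\gamma}$ (with $f(0)=\infty$ in the first case if $\gamma>0$). Put $\rho_1=d-\gamma$ in the first case, $\rho_1=d$ in the second case, and $\rho_2=\frac{d+1}{2}-\gamma$ in both cases. Let $\|f\|_1=\int_{\mathbb R^d}f$, let $f^{1\star}=f$, $f^{n\star}(x)=\int_{\mathbb R^d}f(x-y)f^{(n-1)\star}(y)\,dy$ for $n\ge2$, and for $\lambda>0$ let $$p_\lambda(x)=e^{-\lambda\|f\|_1}\sum_{n=1}^\infty\frac{\lambda^n f^{n\star}(x)}{n!}$$ be the density of the absolutely continuous part of the compound Poisson measure with parameter $\lambda$ built on $f$. Call $C_1,C_2\ge1$ comparison constants of $f$ if $f(x)\le C_1f(y)$ whenever $1\le|x|\le|y|\le|x|+1$, and $f(x)\le C_2f(2x)$ whenever $|x|\le1$; for such constants put $M_2=(C_1\vee C_2)\|f\|_1$.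 Then $\|f\|_1<\infty$, comparison constants of $f$ exist, and there are constants $E_1,\dots,E_6>0$ (depending only on $d$, $m$, $\gamma$ and the choice of $g$) such that for every $x\in\mathbb R^d$ with $|x|\ge1$ and every $\lambda>0$ the following holds. (1) If $\lambda|x|^{\frac{d+1}{2}-\gamma}\le1$, then $$E_1\le\frac{p_\lambda(x)}{\lambda e^{-\lambda\|f\|_1}e^{-m|x|}|x|^{-\gamma}}\le E_2.$$ (2) If $\lambda|x|^{\frac{d+1}{2}-\gamma}\ge1$, then for all comparison constants $C_1,C_2$ of $f$ $$E_3\exp\Big(E_4\big(\lambda|x|^{\frac{d+1}{2}-\gamma}\big)^{\frac1{\rho_1+1}}\Big)\le\frac{p_\lambda(x)}{e^{-\lambda\|f\|_1}e^{-m|x|}|x|^{-\frac{d+1}{2}}}\le E_5e^{\lambda M_2}\exp\Big(E_6\big(\lambda|x|^{\frac{d+1}{2}-\gamma}\big)^{\frac1{\rho_2+1}}\Big).$$ -/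

import Mathlib

open MeasureTheory
open scoped ENNReal

/-- The pure power profile `g(r) = r ^ (-γ)` for `r ≥ 0`; for `γ > 0` its value at `0` is `∞`. -/
noncomputable def powerProfile (γ : ℝ) (r : ℝ) : ℝ≥0∞ :=
  (ENNReal.ofReal r) ^ (-γ)

/-- The truncated power profile `g(r) = (1 ∨ r) ^ (-γ)`. -/
noncomputable def truncatedPowerProfile (γ : ℝ) (r : ℝ) : ℝ≥0∞ :=
  (ENNReal.ofReal (max 1 r)) ^ (-γ)

/-- The function `f(x) = e ^ (-m |x|) g(|x|)` on Euclidean `d`-space, with values in `[0, ∞]`. -/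
noncomputable def expDensity {d : ℕ} (m : ℝ) (g : ℝ → ℝ≥0∞) (x : EuclideanSpace ℝ (Fin d)) :
    ℝ≥0∞ :=
  ENNReal.ofReal (Real.exp (-m * ‖x‖)) * g ‖x‖

/-- The norm `‖f‖₁` of a `[0, ∞]`-valued function (meaningful if the integral is finite). -/
noncomputable def l1Norm {d : ℕ} (f : EuclideanSpace ℝ (Fin d) → ℝ≥0∞) : ℝ :=
  (∫⁻ x, f x).toReal

/-- `convPow f n` is the `(n + 1)`-fold convolution of `f` with itself:
`convPow f 0 = f` and `convPow f (n + 1) x = ∫ convPow f n y * f (x - y) dy`. -/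
noncomputable def convPow {d : ℕ} (f : EuclideanSpace ℝ (Fin d) → ℝ≥0∞) :
    ℕ → EuclideanSpace ℝ (Fin d) → ℝ≥0∞
  | 0 => f
  | n + 1 => lconvolution (convPow f n) f volume

/-- The density `p_λ(x) = e ^ (-λ ‖f‖₁) ∑_{n ≥ 1} λ ^ n f^{n⋆}(x) / n!` of the absolutely continuous
part of the compound Poisson measure built on `f`. The sum is indexed by `n - 1`. -/
noncomputable def compoundPoissonDensity {d : ℕ} (f : EuclideanSpace ℝ (Fin d) → ℝ≥0∞) (lam : ℝ)
    (x : EuclideanSpace ℝ (Fin d)) : ℝ≥0∞ :=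
  ENNReal.ofReal (Real.exp (-lam * l1Norm f)) *
    ∑' n : ℕ, ENNReal.ofReal (lam ^ (n + 1) / ((n + 1).factorial : ℝ)) * convPow f n x

/-- `C₁, C₂ ≥ 1` are comparison constants of `f`: `f x ≤ C₁ f y` for `1 ≤ |x| ≤ |y| ≤ |x| + 1`,
and `f x ≤ C₂ f (2 x)` for `|x| ≤ 1`. -/
structure ComparisonConstants {d : ℕ} (f : EuclideanSpace ℝ (Fin d) → ℝ≥0∞) (C₁ C₂ : ℝ) :
    Prop where
  one_le_left : 1 ≤ C₁
  one_le_right : 1 ≤ C₂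
  le_of_norm_le : ∀ x y : EuclideanSpace ℝ (Fin d), 1 ≤ ‖x‖ → ‖x‖ ≤ ‖y‖ → ‖y‖ ≤ ‖x‖ + 1 →
    f x ≤ ENNReal.ofReal C₁ * f y
  le_two_smul : ∀ x : EuclideanSpace ℝ (Fin d), ‖x‖ ≤ 1 →
    f x ≤ ENNReal.ofReal C₂ * f ((2 : ℝ) • x)

/-- The constant `M₂ = (C₁ ∨ C₂) ‖f‖₁`. -/
noncomputable def doublingConst {d : ℕ} (f : EuclideanSpace ℝ (Fin d) → ℝ≥0∞) (C₁ C₂ : ℝ) : ℝ :=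
  max C₁ C₂ * l1Norm f

/-! ### Convolution powers: mass, pointwise bounds, exponential tilting. -/

section Convolution

variable {d : ℕ} {f : EuclideanSpace ℝ (Fin d) → ℝ≥0∞}

/-! Write R = |x|, p = (d+1)/2, β = p - γ, u = λR^β, and let N be the number of jumps. Tilting f by
e^{a⟨e,y⟩} with e = x/R commutes with convolution and extracts e^{-aR} from f^{N⋆}(x).

Upper bound. In a cone around e, |y| exceeds t = ⟨e,y⟩ by a multiple of |y_⊥|²/t, so the tilted f is
e^{-(m-a)t} t^{-γ} times a Gaussian of variance of order t in d-1 directions; its mass is at most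
C(m-a)^{-β} (`exists_lintegral_expTilt_le`). Some jump has length at least R/N
(`convPow_le_of_forall_le`). Taking m-a of order N/R, possible for N ≤ 2R, gives f^{N⋆}(x) ≤ e^{-mR}
R^{-p} (AR^β)^N N^{-βN}. For N ≥ 2R no tilt is needed: allowing (e^m ‖f‖₁)^N in place of ‖f‖₁^N pays
for e^{-mR}R^{-p}. Summed against λ^N/N!, the two regimes give exp(const · u^{1/(β+1)}) and exp(λ
e^m ‖f‖₁); and e^m ≤ C₁, as seen by comparing f at norms 1 and 2.

Lower bound. Tilt by a = m and keep the N partial sums in translates, along the segment from 0 to x,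
of a box of length of order R/N and transverse size √R/N (`le_convPow_of_forall_le`). The transverse
displacement lengthens each step by a bounded amount, so f^{N⋆}(x) ≥ e^{-mR} R^{-p} (cR^β)^N
N^{-ρ₁N}. The single term with N near u^{1/(ρ₁+1)}, up to a constant factor, suffices. When u ≤ 1
the term N = 1 dominates. -/

theorem measurable_convPow (hf : Measurable f) (n : ℕ) : Measurable (convPow f n) := by
  induction n with
  | zero => exact hf
  | succ n ih => exact measurable_lconvolution volume ih hf

theorem convPow_succ_apply (n : ℕ) (x : EuclideanSpace ℝ (Fin d)) :
    convPow f (n + 1) x = ∫⁻ y, convPow f n y * f (-y + x) := rfl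

theorem lintegral_convPow (hf : Measurable f) (n : ℕ) :
    ∫⁻ x, convPow f n x = (∫⁻ x, f x) ^ (n + 1) := by
  induction n with
  | zero => simp [convPow]
  | succ n ih =>
    have hm := measurable_convPow hf n
    simp_rw [convPow_succ_apply]
    rw [lintegral_lintegral_swap (by fun_prop)]
    have h : ∀ y, ∫⁻ x, convPow f n y * f (-y + x) = convPow f n y * ∫⁻ x, f x := fun y ↦ by
      rw [lintegral_const_mul _ (by fun_prop), lintegral_add_left_eq_self]
    simp_rw [h]
    rw [lintegral_mul_const _ hm, ih, pow_succ _ (n + 1)]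

/-- One of `n + 1` jumps with total displacement of norm at least `(n + 1) * s` has norm at
least `s`. -/
theorem convPow_le_of_forall_le (hf : Measurable f) {s : ℝ} {S Φ : ℝ≥0∞}
    (hS : ∀ y, s ≤ ‖y‖ → f y ≤ S) (hΦ : ∫⁻ y, f y ≤ Φ) (n : ℕ) :
    ∀ x : EuclideanSpace ℝ (Fin d), (n + 1) * s ≤ ‖x‖ → convPow f n x ≤ (n + 1) * S * Φ ^ n := by
  induction n with
  | zero => intro x hx; simpa [convPow] using hS x (by simpa using hx)
  | succ n ih =>
    intro x hx
    have hm := measurable_convPow hf n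
    have hpt : ∀ y, convPow f n y * f (-y + x) ≤
        (n + 1) * S * Φ ^ n * f (-y + x) + convPow f n y * S := by
      intro y
      -- Either the first `n + 1` jumps already travel `(n + 1) * s`, or the last one has length at
      -- least `s`. Adding the two bounds avoids splitting the domain.
      by_cases hy : (n + 1) * s ≤ ‖y‖
      · exact (mul_le_mul_left (ih y hy) _).trans le_self_add
      · refine (mul_le_mul_right (hS _ ?_) _).trans le_add_self
        have h1 : ‖x‖ ≤ ‖y‖ + ‖-y + x‖ := by simpa using norm_add_le y (-y + x)
        push_cast at hx
        linarith
    calc convPow f (n + 1) x = ∫⁻ y, convPow f n y * f (-y + x) := rfl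
      _ ≤ ∫⁻ y, ((n + 1) * S * Φ ^ n * f (-y + x) + convPow f n y * S) := lintegral_mono hpt
      _ = (n + 1) * S * Φ ^ n * (∫⁻ y, f y) + (∫⁻ y, f y) ^ (n + 1) * S := by
        rw [lintegral_add_left (by fun_prop), lintegral_const_mul _ (by fun_prop),
          lintegral_mul_const _ hm, lintegral_convPow hf]
        congr 2
        have := lintegral_sub_left_eq_self (μ := (volume : Measure (EuclideanSpace ℝ (Fin d)))) f x
        rw [← this]
        simp_rw [neg_add_eq_sub]
      _ ≤ (n + 1) * S * Φ ^ n * Φ + Φ ^ (n + 1) * S := by gcongr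
      _ = ((n + 1 : ℕ) + 1) * S * Φ ^ (n + 1) := by push_cast; ring

/-- The exponential tilt `y ↦ exp ⟪v, y⟫ f y`. -/
noncomputable def expTilt (v : EuclideanSpace ℝ (Fin d)) (f : EuclideanSpace ℝ (Fin d) → ℝ≥0∞)
    (y : EuclideanSpace ℝ (Fin d)) : ℝ≥0∞ :=
  ENNReal.ofReal (Real.exp (inner ℝ v y)) * f y

theorem measurable_expTilt (v : EuclideanSpace ℝ (Fin d)) (hf : Measurable f) :
    Measurable (expTilt v f) := by
  unfold expTilt
  fun_prop

/-- The weight is multiplicative, exp⟪v, x⟫ = exp⟪v, y⟫ exp⟪v, x - y⟫, so it distributes over the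
convolution factors. -/
theorem convPow_expTilt (v : EuclideanSpace ℝ (Fin d)) (n : ℕ) :
    convPow (expTilt v f) n = expTilt v (convPow f n) := by
  induction n with
  | zero => rfl
  | succ n ih =>
    ext x
    rw [convPow_succ_apply, ih, expTilt, convPow_succ_apply,
      ← lintegral_const_mul' _ _ ENNReal.ofReal_ne_top]
    refine lintegral_congr fun y ↦ ?_
    have h : ENNReal.ofReal (Real.exp (inner ℝ v x)) = ENNReal.ofReal (Real.exp (inner ℝ v y)) *
        ENNReal.ofReal (Real.exp (inner ℝ v (-y + x))) := by
      rw [← ENNReal.ofReal_mul (Real.exp_pos _).le, ← Real.exp_add, ← inner_add_right]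
      simp
    rw [h, expTilt, expTilt]
    ring

theorem convPow_eq_mul_convPow_expTilt (v : EuclideanSpace ℝ (Fin d)) (n : ℕ)
    (x : EuclideanSpace ℝ (Fin d)) :
    convPow f n x = ENNReal.ofReal (Real.exp (-inner ℝ v x)) * convPow (expTilt v f) n x := by
  rw [convPow_expTilt, expTilt, ← mul_assoc, ← ENNReal.ofReal_mul (Real.exp_pos _).le,
    ← Real.exp_add]
  simp

/-- A lower bound obtained by confining the `k`-th partial sum to `k • q + B`. -/
theorem le_convPow_of_forall_le {κ : ℝ≥0∞} {q : EuclideanSpace ℝ (Fin d)}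
    {B : Set (EuclideanSpace ℝ (Fin d))} (hB : MeasurableSet B) (h0 : 0 ∈ B)
    (hκ : ∀ w ∈ B, ∀ w' ∈ B, κ ≤ f (q + (w - w'))) (n : ℕ) :
    ∀ w ∈ B, κ ^ (n + 1) * volume B ^ n ≤ convPow f n (((n : ℝ) + 1) • q + w) := by
  induction n with
  | zero => intro w hw; simpa [convPow] using hκ w hw 0 h0
  | succ n ih =>
    intro w hw
    rw [convPow_succ_apply,
      ← lintegral_add_left_eq_self _ (((n : ℝ) + 1) • q)]
    calc κ ^ (n + 1 + 1) * volume B ^ (n + 1)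
        = ∫⁻ _ in B, κ ^ (n + 1) * volume B ^ n * κ := by
          rw [setLIntegral_const]; ring
      _ ≤ ∫⁻ z in B, convPow f n (((n : ℝ) + 1) • q + z) *
            f (-(((n : ℝ) + 1) • q + z) + (((n + 1 : ℕ) + 1 : ℝ) • q + w)) := by
          refine setLIntegral_mono' hB fun z hz ↦ mul_le_mul' (ih z hz) ?_
          have h : -(((n : ℝ) + 1) • q + z) + (((n + 1 : ℕ) + 1 : ℝ) • q + w) = q + (w - z) := by
            push_cast
            module
          rw [h]
          exact hκ w hw z hz
      _ ≤ _ := setLIntegral_le_lintegral _ _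

end Convolution

/-! ### Gaussian, Gamma and polar-coordinate integrals. -/

section KernelIntegral

theorem lintegral_exp_neg_mul_sum_sq (k : ℕ) {b : ℝ} (hb : 0 < b) :
    ∫⁻ z : Fin k → ℝ, ENNReal.ofReal (Real.exp (-b * ∑ i, z i ^ 2)) =
      ENNReal.ofReal ((Real.pi / b) ^ ((k : ℝ) / 2)) := by
  have h : ∀ z : Fin k → ℝ, Real.exp (-b * ∑ i, z i ^ 2) = ∏ i, Real.exp (-b * z i ^ 2) := by
    intro z
    rw [← Real.exp_sum, Finset.mul_sum]
  simp_rw [h]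
  rw [← ofReal_integral_eq_lintegral_ofReal]
  · rw [integral_fintype_prod_volume_eq_pow (fun x : ℝ ↦ Real.exp (-b * x ^ 2)), integral_gaussian,
      Real.sqrt_eq_rpow, ← Real.rpow_natCast, ← Real.rpow_mul (by positivity), Fintype.card_fin]
    congr 2
    ring
  · exact Integrable.fintype_prod (f := fun _ x ↦ Real.exp (-b * x ^ 2))
      fun _ ↦ integrable_exp_neg_mul_sq hb
  · exact Filter.Eventually.of_forall fun z ↦ by positivity

theorem lintegral_rpow_mul_exp_neg {p ε : ℝ} (hp : 0 < p) (hε : 0 < ε) :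
    ∫⁻ t in Set.Ioi (0 : ℝ), ENNReal.ofReal (t ^ (p - 1) * Real.exp (-(ε * t))) =
      ENNReal.ofReal (Real.Gamma p * ε ^ (-p)) := by
  rw [← ofReal_integral_eq_lintegral_ofReal]
  · rw [Real.integral_rpow_mul_exp_neg_mul_Ioi hp hε, one_div, Real.inv_rpow hε.le,
      Real.rpow_neg hε.le, mul_comm]
  · have := integrableOn_rpow_mul_exp_neg_mul_rpow (s := p - 1) (p := 1) (b := ε) (by linarith)
      one_pos hε
    simpa [IntegrableOn] using this
  · filter_upwards [ae_restrict_mem measurableSet_Ioi] with t ht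
    have : 0 < t := ht
    positivity

/-- The integral over a half-space of an exponential in the first coordinate, times a Gaussian of
variance proportional to the first coordinate in the others. -/
theorem lintegral_halfSpace_exp_mul_gaussian (k : ℕ) {c ε γ : ℝ} (hc : 0 < c) (hε : 0 < ε)
    (hγ : γ < ((k : ℝ) + 2) / 2) :
    ∫⁻ y : Fin (k + 1) → ℝ, (Set.Ioi (0 : ℝ)).indicator (fun t ↦
      ENNReal.ofReal (t ^ (-γ) * Real.exp (-(ε * t)) *
        Real.exp (-(c / t) * ∑ i : Fin k, y i.succ ^ 2))) (y 0) =
      ENNReal.ofReal ((Real.pi / c) ^ ((k : ℝ) / 2) * Real.Gamma (((k : ℝ) + 2) / 2 - γ) *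
        ε ^ (-(((k : ℝ) + 2) / 2 - γ))) := by
  set G : ℝ × (Fin k → ℝ) → ℝ≥0∞ := fun p ↦ (Set.Ioi (0 : ℝ)).indicator (fun t ↦
      ENNReal.ofReal (t ^ (-γ) * Real.exp (-(ε * t)) *
        Real.exp (-(c / t) * ∑ i : Fin k, p.2 i ^ 2))) p.1 with hG
  have hGm : Measurable G := by
    have h1 : G = (Prod.fst ⁻¹' Set.Ioi (0 : ℝ)).indicator (fun p : ℝ × (Fin k → ℝ) ↦
        ENNReal.ofReal (p.1 ^ (-γ) * Real.exp (-(ε * p.1)) *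
        Real.exp (-(c / p.1) * ∑ i : Fin k, p.2 i ^ 2))) := by
      ext p
      simp only [hG, Set.indicator, Set.mem_preimage]
    rw [h1]
    exact Measurable.indicator (by fun_prop) (measurable_fst measurableSet_Ioi)
  have hmp := volume_preserving_piFinSuccAbove (fun _ : Fin (k + 1) ↦ ℝ) 0
  have h2 := hmp.lintegral_comp hGm
  have h3 : ∫⁻ y : Fin (k + 1) → ℝ, (Set.Ioi (0 : ℝ)).indicator (fun t ↦
      ENNReal.ofReal (t ^ (-γ) * Real.exp (-(ε * t)) *
        Real.exp (-(c / t) * ∑ i : Fin k, y i.succ ^ 2))) (y 0) = ∫⁻ p, G p := by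
    rw [← h2]
    rfl
  rw [h3, Measure.volume_eq_prod, lintegral_prod _ hGm.aemeasurable]
  calc ∫⁻ t, ∫⁻ z, G (t, z)
      = ∫⁻ t in Set.Ioi (0 : ℝ), ENNReal.ofReal ((Real.pi / c) ^ ((k : ℝ) / 2)) *
          ENNReal.ofReal (t ^ (((k : ℝ) + 2) / 2 - γ - 1) * Real.exp (-(ε * t))) := by
        rw [← lintegral_indicator measurableSet_Ioi]
        refine lintegral_congr fun t ↦ ?_
        by_cases ht : t ∈ Set.Ioi (0 : ℝ)
        · have ht' : 0 < t := ht
          simp only [hG, Set.indicator_of_mem ht]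
          simp_rw [ENNReal.ofReal_mul (p := t ^ (-γ) * Real.exp (-(ε * t))) (by positivity)]
          rw [lintegral_const_mul' _ _ ENNReal.ofReal_ne_top,
            lintegral_exp_neg_mul_sum_sq k (by positivity : 0 < c / t),
            ← ENNReal.ofReal_mul (by positivity), ← ENNReal.ofReal_mul (by positivity)]
          congr 1
          have e1 : Real.pi / (c / t) = Real.pi / c * t := by field_simp
          have e2 : t ^ (((k : ℝ) + 2) / 2 - γ - 1) = t ^ (-γ) * t ^ ((k : ℝ) / 2) := by
            rw [← Real.rpow_add ht']
            congr 1
            ring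
          rw [e1, Real.mul_rpow (by positivity) ht'.le, e2]
          ring
        · simp [hG, Set.indicator_of_notMem ht]
    _ = _ := by
        rw [lintegral_const_mul' _ _ ENNReal.ofReal_ne_top,
          lintegral_rpow_mul_exp_neg (by linarith) hε, ← ENNReal.ofReal_mul (by positivity),
          mul_assoc]

variable {d : ℕ}

theorem exists_orthonormalBasis_apply_zero_eq {k : ℕ} {e : EuclideanSpace ℝ (Fin (k + 1))}
    (he : ‖e‖ = 1) :
    ∃ b : OrthonormalBasis (Fin (k + 1)) ℝ (EuclideanSpace ℝ (Fin (k + 1))), b 0 = e := by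
  have hv : Orthonormal ℝ (({0} : Set (Fin (k + 1))).domRestrict fun _ ↦ e) := by
    refine ⟨fun _ ↦ he, fun i j hij ↦ (hij (Subsingleton.elim i j)).elim⟩
  obtain ⟨b, hb⟩ := hv.exists_orthonormalBasis_extension_of_card_eq (by simp)
  exact ⟨b, hb 0 rfl⟩

theorem norm_sq_eq_inner_sq_add {k : ℕ} {e : EuclideanSpace ℝ (Fin (k + 1))}
    {b : OrthonormalBasis (Fin (k + 1)) ℝ (EuclideanSpace ℝ (Fin (k + 1)))} (hb : b 0 = e)
    (y : EuclideanSpace ℝ (Fin (k + 1))) :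
    ‖y‖ ^ 2 = inner ℝ e y ^ 2 + ∑ i : Fin k, (b.repr y i.succ) ^ 2 := by
  rw [← LinearIsometryEquiv.norm_map b.repr y, EuclideanSpace.norm_sq_eq, Fin.sum_univ_succ]
  simp [b.repr_apply_apply, hb]

theorem lintegral_exp_neg_mul_norm_mul_rpow_ne_top (hd : 1 ≤ d) {c γ : ℝ} (hc : 0 < c)
    (hγ : γ < d) :
    ∫⁻ y : EuclideanSpace ℝ (Fin d), ENNReal.ofReal (Real.exp (-c * ‖y‖) * ‖y‖ ^ (-γ)) ≠ ∞ := by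
  have : Nontrivial (EuclideanSpace ℝ (Fin d)) := by
    have : Nonempty (Fin d) := ⟨⟨0, hd⟩⟩
    exact inferInstance
  have h : Integrable (fun y : EuclideanSpace ℝ (Fin d) ↦
      Real.exp (-c * ‖y‖) * ‖y‖ ^ (-γ)) volume := by
    refine (integrable_fun_norm_addHaar (volume : Measure (EuclideanSpace ℝ (Fin d)))
      (f := fun r ↦ Real.exp (-c * r) * r ^ (-γ))).2 ?_
    have h1 := integrableOn_rpow_mul_exp_neg_mul_rpow (s := d - 1 - γ) (p := 1) (b := c)
      (by linarith) one_pos hc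
    refine h1.congr_fun (fun r hr ↦ ?_) measurableSet_Ioi
    have hr' : 0 < r := hr
    simp only [Real.rpow_one, finrank_euclideanSpace, Fintype.card_fin, smul_eq_mul]
    rw [← Real.rpow_natCast, Nat.cast_sub hd, Nat.cast_one, sub_eq_add_neg (d - 1 : ℝ) γ,
      Real.rpow_add hr']
    ring
  exact ((hasFiniteIntegral_iff_ofReal (Filter.Eventually.of_forall fun y ↦
    by positivity)).1 h.2).ne

end KernelIntegral

/-! ### Mass of the tilted density. -/

section KernelIntegral

theorem powerProfile_of_pos {γ r : ℝ} (hr : 0 < r) :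
    powerProfile γ r = ENNReal.ofReal (r ^ (-γ)) :=
  ENNReal.ofReal_rpow_of_pos hr

theorem truncatedPowerProfile_eq (γ r : ℝ) :
    truncatedPowerProfile γ r = ENNReal.ofReal ((max 1 r) ^ (-γ)) :=
  ENNReal.ofReal_rpow_of_pos (by positivity)

/-- Here `N = ‖y‖`, `t` is its component along the tilt and `Q` the squared transverse part. Since N
< 2t, N - t = Q/(N + t) ≥ Q/(3t), which produces the Gaussian factor. -/
theorem exp_sub_mul_rpow_le {a m γ N t Q : ℝ} (hγ : 0 ≤ γ) (ha : m / 2 ≤ a) (ham : a ≤ m)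
    (hm : 0 < m) (hN : 0 < N) (hQ : 0 ≤ Q) (h : N ^ 2 = t ^ 2 + Q) (ht : N / 2 < t) :
    Real.exp (a * t - m * N) * N ^ (-γ) ≤
      t ^ (-γ) * Real.exp (-((m - a) * t)) * Real.exp (-(m / 6 / t) * Q) := by
  have ht0 : 0 < t := by linarith
  have htN : t ≤ N := by nlinarith
  have h1 : N ^ (-γ) ≤ t ^ (-γ) := Real.rpow_le_rpow_of_nonpos ht0 htN (by linarith)
  have h2 : Q / (3 * t) ≤ N - t := by
    rw [div_le_iff₀ (by positivity)]
    nlinarith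
  have h3 : a * t - m * N ≤ -((m - a) * t) + -(m / 6 / t) * Q := by
    have e : -(m / 6 / t) * Q = -(m / 2) * (Q / (3 * t)) := by field_simp; ring
    rw [e]
    nlinarith
  rw [mul_assoc, ← Real.exp_add, mul_comm]
  gcongr

/-- Inside the cone ⟨e,y⟩ > ‖y‖/2 the Gaussian bound integrates to the stated power of m - a.
Outside it the tilt uses at most half of the decay, leaving a finite constant `I`, absorbed because
m ≥ m - a. -/
theorem exists_lintegral_expTilt_le {d : ℕ} (hd : 1 ≤ d) {m γ : ℝ} (hm : 0 < m) (hγ₀ : 0 ≤ γ)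
    (hγ : γ < ((d : ℝ) + 1) / 2) :
    ∃ C : ℝ, 0 < C ∧ ∀ e : EuclideanSpace ℝ (Fin d), ‖e‖ = 1 → ∀ a : ℝ, m / 2 ≤ a → a < m →
      ∫⁻ y, expTilt (a • e) (expDensity m (powerProfile γ)) y ≤
        ENNReal.ofReal (C * (m - a) ^ (-(((d : ℝ) + 1) / 2 - γ))) := by
  obtain ⟨k, rfl⟩ : ∃ k, d = k + 1 := ⟨d - 1, by omega⟩
  have hcast : (((k + 1 : ℕ) : ℝ) + 1) / 2 = ((k : ℝ) + 2) / 2 := by push_cast; ring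
  rw [hcast] at hγ ⊢
  set β := ((k : ℝ) + 2) / 2 - γ with hβ
  have hβ0 : 0 < β := by linarith
  have hk0 : (0 : ℝ) ≤ k := Nat.cast_nonneg k
  have hfar := lintegral_exp_neg_mul_norm_mul_rpow_ne_top hd (c := m / 2) (γ := γ) (by positivity)
    (by push_cast; linarith)
  set I := ∫⁻ y : EuclideanSpace ℝ (Fin (k + 1)),
    ENNReal.ofReal (Real.exp (-(m / 2) * ‖y‖) * ‖y‖ ^ (-γ)) with hI
  have hΓ := Real.Gamma_pos_of_pos hβ0
  set C₀ := (Real.pi / (m / 6)) ^ ((k : ℝ) / 2) * Real.Gamma β with hC₀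
  have hC₀0 : 0 < C₀ := by positivity
  refine ⟨C₀ + I.toReal * m ^ β, by positivity, fun e he a ha ham ↦ ?_⟩
  obtain ⟨b, hb⟩ := exists_orthonormalBasis_apply_zero_eq he
  set G : (Fin (k + 1) → ℝ) → ℝ≥0∞ := fun y ↦ (Set.Ioi (0 : ℝ)).indicator (fun t ↦
      ENNReal.ofReal (t ^ (-γ) * Real.exp (-((m - a) * t)) *
        Real.exp (-(m / 6 / t) * ∑ i : Fin k, y i.succ ^ 2))) (y 0) with hG
  have hGm : Measurable G := by
    have h1 : G = ((fun y : Fin (k + 1) → ℝ ↦ y 0) ⁻¹' Set.Ioi (0 : ℝ)).indicator (fun y ↦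
        ENNReal.ofReal (y 0 ^ (-γ) * Real.exp (-((m - a) * y 0)) *
        Real.exp (-(m / 6 / y 0) * ∑ i : Fin k, y i.succ ^ 2))) := by
      ext p
      simp only [hG, Set.indicator, Set.mem_preimage]
    rw [h1]
    exact Measurable.indicator (by fun_prop) ((measurable_pi_apply 0) measurableSet_Ioi)
  have hmp := (PiLp.volume_preserving_ofLp (Fin (k + 1))).comp b.measurePreserving_repr
  have : Nontrivial (EuclideanSpace ℝ (Fin (k + 1))) := inferInstance
  have hne : ∀ᵐ y : EuclideanSpace ℝ (Fin (k + 1)), y ≠ 0 := by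
    simp [ae_iff]
  calc ∫⁻ y, expTilt (a • e) (expDensity m (powerProfile γ)) y
      ≤ ∫⁻ y : EuclideanSpace ℝ (Fin (k + 1)), (G ((WithLp.ofLp ∘ b.repr) y) +
          ENNReal.ofReal (Real.exp (-(m / 2) * ‖y‖) * ‖y‖ ^ (-γ))) := by
        refine lintegral_mono_ae ?_
        filter_upwards [hne] with y hy
        have hN : 0 < ‖y‖ := norm_pos_iff.2 hy
        have h0 : b.repr y 0 = inner ℝ e y := by rw [b.repr_apply_apply, hb]
        rw [expTilt, expDensity, powerProfile_of_pos hN, ← ENNReal.ofReal_mul (by positivity),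
          ← ENNReal.ofReal_mul (by positivity), ← mul_assoc, ← Real.exp_add,
          real_inner_smul_left, neg_mul, ← sub_eq_add_neg]
        by_cases ht : ‖y‖ / 2 < inner ℝ e y
        · refine le_add_of_le_of_nonneg ?_ zero_le
          simp only [hG, Function.comp_apply, h0]
          rw [Set.indicator_of_mem (show inner ℝ e y ∈ Set.Ioi (0 : ℝ) from by
            rw [Set.mem_Ioi]; linarith)]
          exact ENNReal.ofReal_le_ofReal (exp_sub_mul_rpow_le hγ₀ ha ham.le hm hN
            (Finset.sum_nonneg fun i _ ↦ sq_nonneg _) (norm_sq_eq_inner_sq_add hb y) ht)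
        · refine le_add_of_nonneg_of_le zero_le (ENNReal.ofReal_le_ofReal ?_)
          gcongr
          push Not at ht
          nlinarith
    _ = ENNReal.ofReal (C₀ * (m - a) ^ (-β)) + I := by
        rw [lintegral_add_left (f := fun y ↦ G ((WithLp.ofLp ∘ b.repr) y))
            (hGm.comp hmp.measurable), hmp.lintegral_comp hGm,
          lintegral_halfSpace_exp_mul_gaussian k (by positivity) (by linarith) hγ]
    _ ≤ _ := by
        have hε : 0 < m - a := by linarith
        nth_rewrite 1 [← ENNReal.ofReal_toReal hfar]
        rw [← ENNReal.ofReal_add (by positivity) (by positivity), add_mul, mul_assoc I.toReal]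
        refine ENNReal.ofReal_le_ofReal (add_le_add_right ?_ _)
        refine le_mul_of_one_le_right ENNReal.toReal_nonneg ?_
        rw [Real.rpow_neg hε.le, ← div_eq_mul_inv, ← Real.div_rpow hm.le hε.le]
        exact Real.one_le_rpow ((one_le_div hε).2 (by linarith)) hβ0.le

end KernelIntegral

/-! ### Upper bounds for convolution powers, with few or many jumps. -/

section UpperBounds

theorem natCast_succ_rpow_le_exp_pow (n : ℕ) {q : ℝ} (hq : 0 ≤ q) :
    ((n : ℝ) + 1) ^ q ≤ Real.exp q ^ (n + 1) := by
  have h : (n : ℝ) + 1 ≤ Real.exp ((n : ℝ) + 1) := by linarith [Real.add_one_le_exp ((n : ℝ) + 1)]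
  refine (Real.rpow_le_rpow (by positivity) h hq).trans_eq ?_
  rw [← Real.exp_mul, ← Real.exp_nat_mul]
  push_cast
  ring_nf

theorem rpow_le_mul_exp {t q c : ℝ} (ht : 0 ≤ t) (hq : 0 < q) (hc : 0 < c) :
    t ^ q ≤ (q / c) ^ q * Real.exp (c * t) := by
  have h : t ≤ q / c * Real.exp (c * t / q) := by
    have h1 : c * t / q ≤ Real.exp (c * t / q) := by linarith [Real.add_one_le_exp (c * t / q)]
    calc t = q / c * (c * t / q) := by field_simp
      _ ≤ _ := by gcongr
  refine (Real.rpow_le_rpow ht h hq.le).trans_eq ?_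
  rw [Real.mul_rpow (by positivity) (by positivity), ← Real.exp_mul]
  congr 2
  field_simp

/-- With s = R/(n+1), writing s^{-γ} = s^β s^{-(β+γ)} supplies the missing (n+1)-st factor s^β and
the prefactor R^{-(β+γ)}; leftover powers of n+1 go into the geometric constant. -/
theorem exp_mul_div_rpow_le {m γ β C R : ℝ} (hβ : 0 ≤ β) (hγ : 0 ≤ γ) (hC : 1 ≤ C) (hR : 0 < R)
    (n : ℕ) :
    Real.exp (m / 4 * ((n : ℝ) + 1)) * (((n : ℝ) + 1) * (R / ((n : ℝ) + 1)) ^ (-γ) *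
        (C * (R / ((n : ℝ) + 1)) ^ β) ^ n) ≤
      R ^ (-(β + γ)) * ((C * Real.exp (1 + (β + γ)) * Real.exp (m / 4) * R ^ β) ^ (n + 1) *
        ((n : ℝ) + 1) ^ (-(β * ((n : ℝ) + 1)))) := by
  set N : ℝ := (n : ℝ) + 1 with hN
  have hN0 : 0 < N := by positivity
  set s := R / N with hs
  have hs0 : 0 < s := by positivity
  have e1 : s ^ (-γ) = s ^ β * s ^ (-(β + γ)) := by
    rw [← Real.rpow_add hs0]; congr 1; ring
  have e2 : (s ^ β) ^ (n + 1) = (R ^ β) ^ (n + 1) * N ^ (-(β * N)) := by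
    rw [hs, Real.div_rpow hR.le hN0.le, div_pow, div_eq_mul_inv, Real.rpow_neg hN0.le,
      Real.rpow_mul hN0.le, ← Real.rpow_natCast (N ^ β) (n + 1)]
    push_cast
    rfl
  have e3 : s ^ (-(β + γ)) = R ^ (-(β + γ)) * N ^ (β + γ) := by
    rw [hs, Real.div_rpow hR.le hN0.le, Real.rpow_neg hN0.le, div_inv_eq_mul]
  have e4 : Real.exp (m / 4 * N) = Real.exp (m / 4) ^ (n + 1) := by
    rw [← Real.exp_nat_mul]; push_cast; rw [mul_comm]
  have e5 : N * N ^ (β + γ) = N ^ (1 + (β + γ)) := by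
    rw [Real.rpow_add hN0 1, Real.rpow_one]
  calc Real.exp (m / 4 * N) * (N * s ^ (-γ) * (C * s ^ β) ^ n)
      = Real.exp (m / 4) ^ (n + 1) * (N * N ^ (β + γ)) * C ^ n * (s ^ β) ^ (n + 1) *
          R ^ (-(β + γ)) := by
        rw [e4, e1, e3, mul_pow, pow_succ (s ^ β) n]; ring
    _ ≤ Real.exp (m / 4) ^ (n + 1) * Real.exp (1 + (β + γ)) ^ (n + 1) * C ^ (n + 1) *
          (s ^ β) ^ (n + 1) * R ^ (-(β + γ)) := by
        rw [e5]
        gcongr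
        · exact natCast_succ_rpow_le_exp_pow n (by positivity)
        · omega
    _ = _ := by rw [e2, mul_pow, mul_pow, mul_pow]; ring

variable {d : ℕ} {m γ : ℝ} {f : EuclideanSpace ℝ (Fin d) → ℝ≥0∞}

theorem expTilt_le_of_le_norm (hγ₀ : 0 ≤ γ)
    (hle : ∀ x, f x ≤ expDensity m (powerProfile γ) x) {e : EuclideanSpace ℝ (Fin d)}
    (he : ‖e‖ ≤ 1) {a : ℝ} (ha : 0 ≤ a) (ham : a ≤ m) {s : ℝ} (hs : 0 < s)
    (y : EuclideanSpace ℝ (Fin d)) (hy : s ≤ ‖y‖) :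
    expTilt (a • e) f y ≤ ENNReal.ofReal (s ^ (-γ)) := by
  have hy0 : 0 < ‖y‖ := hs.trans_le hy
  refine (mul_le_mul_right (hle y) _).trans ?_
  rw [expDensity, powerProfile_of_pos hy0, ← ENNReal.ofReal_mul (by positivity),
    ← ENNReal.ofReal_mul (by positivity), ← mul_assoc, ← Real.exp_add]
  refine ENNReal.ofReal_le_ofReal ?_
  have h1 : inner ℝ (a • e) y + -m * ‖y‖ ≤ 0 := by
    have h2 : inner ℝ e y ≤ ‖y‖ :=
      (real_inner_le_norm e y).trans (mul_le_of_le_one_left hy0.le he)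
    rw [real_inner_smul_left]
    nlinarith
  calc _ ≤ 1 * ‖y‖ ^ (-γ) := by gcongr; exact Real.exp_le_one_iff.2 h1
    _ ≤ s ^ (-γ) := by
      rw [one_mul]
      exact Real.rpow_le_rpow_of_nonpos hs hy (by linarith)

/-- Tilting by m - ε with ε = m(n+1)/(4R) costs e^{εR} = e^{m(n+1)/4}, only geometric in n, while
the tilted mass is of order (R/(n+1))^β. -/
theorem exists_convPow_le_of_le_two_mul_norm (hd : 1 ≤ d) (hm : 0 < m) (hγ₀ : 0 ≤ γ)
    (hγ : γ < ((d : ℝ) + 1) / 2) (hf : Measurable f)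
    (hle : ∀ x, f x ≤ expDensity m (powerProfile γ) x) :
    ∃ A : ℝ, 1 ≤ A ∧ ∀ (n : ℕ) (x : EuclideanSpace ℝ (Fin d)), 1 ≤ ‖x‖ → (n : ℝ) + 1 ≤ 2 * ‖x‖ →
      convPow f n x ≤ ENNReal.ofReal (Real.exp (-m * ‖x‖) * ‖x‖ ^ (-(((d : ℝ) + 1) / 2)) *
        ((A * ‖x‖ ^ (((d : ℝ) + 1) / 2 - γ)) ^ (n + 1) *
          ((n : ℝ) + 1) ^ (-((((d : ℝ) + 1) / 2 - γ) * ((n : ℝ) + 1))))) := by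
  obtain ⟨C, hC0, hC⟩ := exists_lintegral_expTilt_le hd hm hγ₀ hγ
  set β := ((d : ℝ) + 1) / 2 - γ with hβ
  have hβ0 : 0 < β := by linarith
  have hp : ((d : ℝ) + 1) / 2 = β + γ := by rw [hβ]; ring
  set C₁ := max 1 (C * (4 / m) ^ β) with hC₁
  refine ⟨C₁ * Real.exp (1 + (β + γ)) * Real.exp (m / 4), ?_, fun n x hx hn ↦ ?_⟩
  · exact one_le_mul_of_one_le_of_one_le (one_le_mul_of_one_le_of_one_le (le_max_left _ _)
      (Real.one_le_exp (by positivity))) (Real.one_le_exp (by positivity))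
  set R := ‖x‖ with hR
  set N : ℝ := (n : ℝ) + 1 with hN
  have hR0 : 0 < R := by linarith
  have hN0 : 0 < N := by positivity
  set s := R / N with hs
  have hs0 : 0 < s := by positivity
  set ε := m / (4 * s) with hε
  have hε0 : 0 < ε := by positivity
  -- The restriction n+1 ≤ 2R enters here: it gives s ≥ 1/2, so the tilt m - ε stays at least m/2.
  have hεm : ε ≤ m / 2 := by
    rw [hε]
    refine div_le_div_of_nonneg_left hm.le two_pos ?_
    have : 1 / 2 ≤ s := by rw [hs, le_div_iff₀ hN0]; linarith
    linarith
  set e := R⁻¹ • x with he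
  have he1 : ‖e‖ = 1 := by
    rw [he, norm_smul, norm_inv, norm_norm, inv_mul_cancel₀ hR0.ne']
  have hex : inner ℝ ((m - ε) • e) x = (m - ε) * R := by
    rw [real_inner_smul_left, he, real_inner_smul_left, real_inner_self_eq_norm_sq, ← hR]
    field_simp
  have hΦ : ∫⁻ y, expTilt ((m - ε) • e) f y ≤ ENNReal.ofReal (C * ε ^ (-β)) := by
    have h1 := hC e he1 (m - ε) (by linarith) (by linarith)
    rw [sub_sub_cancel] at h1
    exact (lintegral_mono fun y ↦ mul_le_mul_right (hle y) _).trans h1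
  have hF := convPow_le_of_forall_le (measurable_expTilt ((m - ε) • e) hf)
    (expTilt_le_of_le_norm hγ₀ hle he1.le (by linarith) (by linarith) hs0) hΦ n x
    (by rw [← hN, hs, mul_div_cancel₀ _ hN0.ne'])
  rw [convPow_eq_mul_convPow_expTilt ((m - ε) • e) n x, hex]
  refine (mul_le_mul_right hF _).trans ?_
  have hNc : ((n : ℝ≥0∞) + 1) = ENNReal.ofReal N := by
    rw [hN, ENNReal.ofReal_add (by positivity) (by positivity)]; simp
  rw [hNc, ← ENNReal.ofReal_pow (by positivity), ← ENNReal.ofReal_mul (by positivity),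
    ← ENNReal.ofReal_mul (by positivity), ← ENNReal.ofReal_mul (by positivity)]
  refine ENNReal.ofReal_le_ofReal ?_
  have e1 : Real.exp (-((m - ε) * R)) = Real.exp (-m * R) * Real.exp (m / 4 * N) := by
    rw [← Real.exp_add]
    congr 1
    rw [hε, hs]
    field_simp
    ring
  have e2 : C * ε ^ (-β) ≤ C₁ * s ^ β := by
    have : ε ^ (-β) = (4 / m) ^ β * s ^ β := by
      rw [Real.rpow_neg hε0.le, ← Real.inv_rpow hε0.le,
        ← Real.mul_rpow (by positivity) hs0.le, hε]
      congr 1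
      field_simp
    rw [this, ← mul_assoc]
    gcongr
    exact le_max_right _ _
  rw [hp, e1, mul_assoc (Real.exp (-m * R)), mul_assoc (Real.exp (-m * R))]
  refine mul_le_mul_of_nonneg_left ?_ (Real.exp_pos _).le
  refine le_trans ?_ (exp_mul_div_rpow_le hβ0.le hγ₀ (le_max_left _ _) hR0 n)
  gcongr

/-- Of the allowed factor e^{m(n+1)}, one half compensates e^{-mR}, as n+1 ≥ 2R, and the other
absorbs every polynomial factor in n+1. -/
theorem exists_convPow_le_of_two_mul_norm_le (hm : 0 < m) (hγ₀ : 0 ≤ γ) (hf : Measurable f)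
    (hle : ∀ x, f x ≤ expDensity m (powerProfile γ) x) (hfin : ∫⁻ x, f x ≠ ∞)
    (hpos : 0 < l1Norm f) {p : ℝ} (hp : 0 ≤ p) :
    ∃ D : ℝ, 0 < D ∧ ∀ (n : ℕ) (x : EuclideanSpace ℝ (Fin d)), 1 ≤ ‖x‖ → 2 * ‖x‖ ≤ (n : ℝ) + 1 →
      convPow f n x ≤ ENNReal.ofReal (Real.exp (-m * ‖x‖) * ‖x‖ ^ (-p) *
        (D * (Real.exp m * l1Norm f) ^ (n + 1))) := by
  set I := l1Norm f with hI
  have hI' : ∫⁻ x, f x = ENNReal.ofReal I := (ENNReal.ofReal_toReal hfin).symm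
  set q := 1 + γ + p with hq
  have hq0 : 0 < q := by positivity
  refine ⟨(q / (m / 2)) ^ q / I, by positivity, fun n x hx hn ↦ ?_⟩
  set R := ‖x‖ with hR
  set N : ℝ := (n : ℝ) + 1 with hN
  have hR0 : 0 < R := by linarith
  have hN0 : 0 < N := by positivity
  have hS : ∀ y, R / N ≤ ‖y‖ → f y ≤ ENNReal.ofReal ((R / N) ^ (-γ)) := by
    intro y hy
    have h := expTilt_le_of_le_norm hγ₀ hle (e := 0) (by simp) le_rfl hm.le
      (by positivity : 0 < R / N) y hy
    simpa [expTilt] using h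
  have hF := convPow_le_of_forall_le hf hS hI'.le n x
    (by rw [← hN, mul_div_cancel₀ _ hN0.ne'])
  refine hF.trans ?_
  have hNc : ((n : ℝ≥0∞) + 1) = ENNReal.ofReal N := by
    rw [hN, ENNReal.ofReal_add (by positivity) (by positivity)]; simp
  rw [hNc, ← ENNReal.ofReal_pow (by positivity), ← ENNReal.ofReal_mul (by positivity),
    ← ENNReal.ofReal_mul (by positivity)]
  refine ENNReal.ofReal_le_ofReal ?_
  have h1 : (R / N) ^ (-γ) ≤ N ^ γ := by
    rw [Real.rpow_neg (by positivity), ← Real.inv_rpow (by positivity), inv_div]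
    exact Real.rpow_le_rpow (by positivity) (div_le_self hN0.le hx) hγ₀
  have h2 : Real.exp (-(m / 2 * N)) ≤ Real.exp (-m * R) := Real.exp_le_exp.2 (by nlinarith)
  have h3 : N ^ (-p) ≤ R ^ (-p) :=
    Real.rpow_le_rpow_of_nonpos hR0 (by linarith) (by linarith)
  have h4 := rpow_le_mul_exp hN0.le hq0 (by positivity : 0 < m / 2)
  have h5 : N * N ^ γ = N ^ q * N ^ (-p) := by
    rw [← Real.rpow_add hN0, ← Real.rpow_one_add' hN0.le (by positivity)]
    congr 1
    rw [hq]; ring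
  have h6 : Real.exp m ^ (n + 1) = Real.exp (m / 2 * N) * Real.exp (m / 2 * N) := by
    rw [← Real.exp_nat_mul, ← Real.exp_add]
    congr 1
    push_cast
    ring
  calc N * (R / N) ^ (-γ) * I ^ n ≤ N * N ^ γ * I ^ n := by gcongr
    _ ≤ ((q / (m / 2)) ^ q * Real.exp (m / 2 * N)) * R ^ (-p) * I ^ n := by rw [h5]; gcongr
    _ = Real.exp (-(m / 2 * N)) * R ^ (-p) *
        ((q / (m / 2)) ^ q / I * (Real.exp m * I) ^ (n + 1)) := by
      rw [mul_pow, h6, Real.exp_neg]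
      field_simp
      ring
    _ ≤ _ := by gcongr

end UpperBounds

/-! ### Summing the series and choosing its large term. -/

section Summation

theorem tsum_pow_succ_div_factorial_le {w : ℝ} (hw : 0 ≤ w) :
    ∑' n : ℕ, ENNReal.ofReal (w ^ (n + 1) / ((n + 1).factorial : ℝ)) ≤
      ENNReal.ofReal (Real.exp w) := by
  have hs := Real.summable_pow_div_factorial w
  rw [← ENNReal.ofReal_tsum_of_nonneg (fun n ↦ by positivity) ((summable_nat_add_iff 1).2 hs)]
  refine ENNReal.ofReal_le_ofReal ?_
  rw [Real.exp_eq_exp_ℝ, NormedSpace.exp_eq_tsum_div]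
  beta_reduce
  rw [hs.tsum_eq_zero_add]
  simp

theorem tsum_mul_le_of_forall_le {lam W K₁ K₂ w₁ w₂ : ℝ} {c : ℕ → ℝ≥0∞} {b : ℕ → ℝ}
    (hlam : 0 < lam) (hW : 0 ≤ W) (hK₁ : 0 ≤ K₁) (hK₂ : 0 ≤ K₂) (hw₁ : 0 ≤ w₁) (hw₂ : 0 ≤ w₂)
    (hc : ∀ n, c n ≤ ENNReal.ofReal (W * b n))
    (hb : ∀ n : ℕ, lam ^ (n + 1) / ((n + 1).factorial : ℝ) * b n ≤
      K₁ * (w₁ ^ (n + 1) / ((n + 1).factorial : ℝ)) +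
        K₂ * (w₂ ^ (n + 1) / ((n + 1).factorial : ℝ))) :
    ∑' n : ℕ, ENNReal.ofReal (lam ^ (n + 1) / ((n + 1).factorial : ℝ)) * c n ≤
      ENNReal.ofReal (W * (K₁ * Real.exp w₁ + K₂ * Real.exp w₂)) := by
  calc ∑' n : ℕ, ENNReal.ofReal (lam ^ (n + 1) / ((n + 1).factorial : ℝ)) * c n
      ≤ ∑' n : ℕ, ENNReal.ofReal W *
          (ENNReal.ofReal K₁ * ENNReal.ofReal (w₁ ^ (n + 1) / ((n + 1).factorial : ℝ)) +
          ENNReal.ofReal K₂ * ENNReal.ofReal (w₂ ^ (n + 1) / ((n + 1).factorial : ℝ))) := by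
        refine ENNReal.tsum_le_tsum fun n ↦ (mul_le_mul_right (hc n) _).trans ?_
        rw [← ENNReal.ofReal_mul (by positivity), ← ENNReal.ofReal_mul hK₁,
          ← ENNReal.ofReal_mul hK₂, ← ENNReal.ofReal_add (by positivity) (by positivity),
          ← ENNReal.ofReal_mul hW]
        refine ENNReal.ofReal_le_ofReal ?_
        calc _ = W * (lam ^ (n + 1) / ((n + 1).factorial : ℝ) * b n) := by ring
          _ ≤ _ := mul_le_mul_of_nonneg_left (hb n) hW
    _ ≤ ENNReal.ofReal W * (ENNReal.ofReal K₁ * ENNReal.ofReal (Real.exp w₁) +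
          ENNReal.ofReal K₂ * ENNReal.ofReal (Real.exp w₂)) := by
        rw [ENNReal.tsum_mul_left, ENNReal.tsum_add, ENNReal.tsum_mul_left, ENNReal.tsum_mul_left]
        gcongr
        · exact tsum_pow_succ_div_factorial_le hw₁
        · exact tsum_pow_succ_div_factorial_le hw₂
    _ = _ := by
        rw [← ENNReal.ofReal_mul hK₁, ← ENNReal.ofReal_mul hK₂,
          ← ENNReal.ofReal_add (by positivity) (by positivity), ← ENNReal.ofReal_mul hW]

/-- With N = n+1 and u = w^{β+1}, the left side is ((w/N)^N)^β w^N, and (w/N)^N ≤ w^N/N! ≤ e^w. -/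
theorem pow_mul_rpow_neg_le {u β : ℝ} (hu : 0 ≤ u) (hβ : 0 ≤ β) (n : ℕ) :
    u ^ (n + 1) * ((n : ℝ) + 1) ^ (-(β * ((n : ℝ) + 1))) ≤
      Real.exp (β * u ^ (1 / (β + 1))) * (u ^ (1 / (β + 1))) ^ (n + 1) := by
  set w := u ^ (1 / (β + 1)) with hw
  have hw0 : 0 ≤ w := by positivity
  set N : ℝ := (n : ℝ) + 1 with hN
  have hN0 : 0 < N := by positivity
  have hNc : ((n + 1 : ℕ) : ℝ) = N := by push_cast; rfl
  have huw : u = w ^ (β + 1) := by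
    rw [hw, ← Real.rpow_mul hu, one_div_mul_cancel (by positivity), Real.rpow_one]
  have h1 : (w / N) ^ (n + 1) ≤ Real.exp w := by
    refine le_trans ?_ (Real.pow_div_factorial_le_exp w hw0 (n + 1))
    rw [div_pow]
    refine div_le_div_of_nonneg_left (by positivity) (by positivity) ?_
    rw [← hNc]
    exact_mod_cast Nat.factorial_le_pow (n + 1)
  have h2 : u ^ (n + 1) * N ^ (-(β * N)) = ((w / N) ^ (n + 1)) ^ β * w ^ (n + 1) := by
    rw [huw, Real.rpow_add_one' hw0 (by positivity), mul_pow, div_pow,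
      Real.div_rpow (by positivity) (by positivity), ← Real.rpow_natCast N (n + 1),
      ← Real.rpow_mul hN0.le, hNc, Real.rpow_neg hN0.le, mul_comm N β,
      ← Real.rpow_natCast (w ^ β) (n + 1), ← Real.rpow_natCast w (n + 1), ← Real.rpow_mul hw0,
      ← Real.rpow_mul hw0, mul_comm β, div_eq_mul_inv]
    ring
  rw [h2, mul_comm β w, Real.exp_mul]
  gcongr

/-- For `u ≥ 1` a single term of the series already has the size of the exponential. -/
theorem exists_mul_exp_le_pow_div_factorial {c u ρ : ℝ} (hc : 0 < c) (hc1 : c ≤ 1) (hu : 1 ≤ u)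
    (hρ : 0 < ρ) :
    ∃ n : ℕ, c * Real.exp (-1) *
        Real.exp ((c * Real.exp (-1)) ^ (1 / (ρ + 1)) * u ^ (1 / (ρ + 1))) ≤
      (c * u) ^ (n + 1) / ((n + 1).factorial : ℝ) * ((n : ℝ) + 1) ^ (-(ρ * ((n : ℝ) + 1))) := by
  rw [← Real.mul_rpow (by positivity) (by positivity)]
  set v := c * Real.exp (-1) * u with hv
  have hv0 : 0 < v := by positivity
  set w := v ^ (1 / (ρ + 1)) with hw
  have hw0 : 0 < w := by positivity
  have hwv : w ^ (ρ + 1) = v := by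
    rw [hw, ← Real.rpow_mul hv0.le, one_div_mul_cancel (by positivity), Real.rpow_one]
  -- If w < 1 the first term is enough. Otherwise N = ⌊w⌋: the factor e^{-1} in `v` makes cu/N^{ρ+1}
  -- ≥ e, so by N! ≤ N^N the term is at least e^N.
  rcases lt_or_ge w 1 with h1 | h1
  · refine ⟨0, ?_⟩
    calc c * Real.exp (-1) * Real.exp w ≤ c * Real.exp (-1) * Real.exp 1 := by gcongr
      _ = c * 1 := by rw [mul_assoc, ← Real.exp_add]; simp
      _ ≤ c * u := by gcongr
      _ = _ := by simp
  · have hfl : 1 ≤ ⌊w⌋₊ := Nat.one_le_floor_iff _ |>.2 h1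
    obtain ⟨n, hn⟩ : ∃ n, ⌊w⌋₊ = n + 1 := ⟨⌊w⌋₊ - 1, by omega⟩
    refine ⟨n, ?_⟩
    set N : ℝ := (n : ℝ) + 1 with hN
    have hN0 : 0 < N := by positivity
    have hNc : ((n + 1 : ℕ) : ℝ) = N := by push_cast; rfl
    have hNw : N ≤ w := by
      have := Nat.floor_le hw0.le
      rwa [hn, hNc] at this
    have hwN : w ≤ N + 1 := by
      have := (Nat.lt_floor_add_one w).le
      rwa [hn, hNc] at this
    have h2 : N ^ (ρ + 1) ≤ v := hwv ▸ Real.rpow_le_rpow hN0.le hNw (by positivity)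
    have h3 : Real.exp 1 ≤ c * u / N ^ (ρ + 1) := by
      rw [le_div_iff₀ (by positivity)]
      calc Real.exp 1 * N ^ (ρ + 1) ≤ Real.exp 1 * v := by gcongr
        _ = c * u * (Real.exp 1 * Real.exp (-1)) := by rw [hv]; ring
        _ = c * u := by rw [← Real.exp_add]; simp
    have h4 : ((n + 1).factorial : ℝ) ≤ N ^ (n + 1) := by
      rw [← hNc]
      exact_mod_cast Nat.factorial_le_pow (n + 1)
    have h5 : (N ^ ρ) ^ (n + 1) = N ^ (ρ * N) := by
      rw [← Real.rpow_natCast (N ^ ρ) (n + 1), ← Real.rpow_mul hN0.le, hNc]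
    calc c * Real.exp (-1) * Real.exp w ≤ 1 * Real.exp (-1) * Real.exp (N + 1) := by gcongr
      _ = Real.exp 1 ^ (n + 1) := by
        rw [one_mul, ← Real.exp_add, ← Real.exp_nat_mul, hNc]
        congr 1
        ring
      _ ≤ (c * u / N ^ (ρ + 1)) ^ (n + 1) := by gcongr
      _ = (c * u) ^ (n + 1) / N ^ (n + 1) * N ^ (-(ρ * N)) := by
        rw [Real.rpow_add_one hN0.ne', div_pow, mul_pow (N ^ ρ) N, h5, Real.rpow_neg hN0.le]
        field_simp
      _ ≤ _ := by gcongr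

end Summation

/-! ### Lower bound for convolution powers by confinement to boxes. -/

section LowerBound

/-- A box in an orthonormal basis starting with `e`. The component along `e` is kept exact in the
norm bound, so that transverse displacement enters a step's length only at second order. -/
theorem exists_box {k : ℕ} {e : EuclideanSpace ℝ (Fin (k + 1))} (he : ‖e‖ = 1) {a t : ℝ}
    (ha : 0 ≤ a) (ht : 0 ≤ t) :
    ∃ B : Set (EuclideanSpace ℝ (Fin (k + 1))), MeasurableSet B ∧ 0 ∈ B ∧
      volume B = ENNReal.ofReal (2 * a * (2 * t) ^ k) ∧ ∀ w ∈ B, ∀ w' ∈ B,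
        |inner ℝ e (w - w')| ≤ 2 * a ∧
        ‖w - w'‖ ^ 2 ≤ inner ℝ e (w - w') ^ 2 + k * (2 * t) ^ 2 := by
  obtain ⟨b, hb⟩ := exists_orthonormalBasis_apply_zero_eq he
  set r : Fin (k + 1) → ℝ := Fin.cons a fun _ ↦ t with hr
  have hr0 : ∀ i, 0 ≤ r i := fun i ↦ by
    refine Fin.cases ?_ (fun i ↦ ?_) i <;> simp [hr, ha, ht]
  have hmp := (PiLp.volume_preserving_ofLp (Fin (k + 1))).comp b.measurePreserving_repr
  have hmem : ∀ w, w ∈ (WithLp.ofLp ∘ b.repr) ⁻¹' Set.Icc (-r) r ↔ ∀ i, |b.repr w i| ≤ r i := by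
    intro w
    simp only [Set.mem_preimage, Set.mem_Icc, Pi.le_def, abs_le, ← forall_and]
    rfl
  refine ⟨(WithLp.ofLp ∘ b.repr) ⁻¹' Set.Icc (-r) r, hmp.measurable measurableSet_Icc, ?_, ?_, ?_⟩
  · rw [hmem]
    simpa using hr0
  · rw [hmp.measure_preimage measurableSet_Icc.nullMeasurableSet, Real.volume_Icc_pi,
      ← ENNReal.ofReal_prod_of_nonneg fun i _ ↦ by simpa using hr0 i, Fin.prod_univ_succ]
    simp only [hr, Pi.neg_apply, Fin.cons_zero, Fin.cons_succ, Finset.prod_const,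
      Finset.card_univ, Fintype.card_fin]
    congr 2 <;> ring
  · intro w hw w' hw'
    rw [hmem] at hw hw'
    have hd : ∀ i, |b.repr (w - w') i| ≤ 2 * r i := fun i ↦ by
      rw [map_sub, PiLp.sub_apply]
      exact (abs_sub _ _).trans (by linarith [hw i, hw' i])
    constructor
    · have := hd 0
      rwa [b.repr_apply_apply, hb] at this
    · rw [norm_sq_eq_inner_sq_add hb]
      refine add_le_add_right ?_ _
      calc ∑ i : Fin k, b.repr (w - w') i.succ ^ 2 ≤ ∑ _i : Fin k, (2 * t) ^ 2 := by
            refine Finset.sum_le_sum fun i _ ↦ ?_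
            have := hd i.succ
            simp only [hr, Fin.cons_succ] at this
            rw [← sq_abs]
            gcongr
        _ = _ := by simp

/-- Lower bound for a profile on an interval `(0, L R / N]`. -/
def ProfileLowerBound (g : ℝ → ℝ≥0∞) (γ δ : ℝ) : Prop :=
  ∀ L r R N : ℝ, 1 ≤ L → 0 < r → 1 ≤ R → 1 ≤ N → r ≤ L * (R / N) →
    ENNReal.ofReal (L ^ (-γ) * R ^ (-γ) * N ^ δ) ≤ g r

theorem profileLowerBound_powerProfile {γ : ℝ} (hγ : 0 ≤ γ) :
    ProfileLowerBound (powerProfile γ) γ γ := by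
  intro L r R N hL hr hR hN h
  rw [powerProfile_of_pos hr]
  refine ENNReal.ofReal_le_ofReal ?_
  calc L ^ (-γ) * R ^ (-γ) * N ^ γ = (L * (R / N)) ^ (-γ) := by
        rw [Real.mul_rpow (by positivity) (by positivity), Real.div_rpow (by positivity)
          (by positivity), Real.rpow_neg (by positivity : 0 ≤ N), div_inv_eq_mul, mul_assoc]
    _ ≤ r ^ (-γ) := Real.rpow_le_rpow_of_nonpos hr h (by linarith)

/-- Truncation removes the gain from short steps: only max(1, r) ≤ LR is available, so no power of N
survives. This is why ρ₁ is d here and d - γ for the pure power. -/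
theorem profileLowerBound_truncatedPowerProfile {γ : ℝ} (hγ : 0 ≤ γ) :
    ProfileLowerBound (truncatedPowerProfile γ) γ 0 := by
  intro L r R N hL hr hR hN h
  rw [truncatedPowerProfile_eq]
  refine ENNReal.ofReal_le_ofReal ?_
  calc L ^ (-γ) * R ^ (-γ) * N ^ (0 : ℝ) = (L * R) ^ (-γ) := by
        rw [Real.mul_rpow (by positivity) (by positivity), Real.rpow_zero, mul_one]
    _ ≤ (max 1 r) ^ (-γ) := by
        refine Real.rpow_le_rpow_of_nonpos (by positivity) (max_le ?_ (h.trans ?_)) (by linarith)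
        · nlinarith
        · gcongr
          exact div_le_self (by linarith) hN

/-- This is √(τ² + q) ≤ τ + q/(2τ) with τ at least 3R/(4N): a transverse displacement of order √R/N
lengthens the step by O(1/N). -/
theorem le_add_div_of_sq_le {k R N z U : ℝ} (hk : 0 ≤ k) (hR : 0 < R) (hN : 0 < N)
    (hz : |z| ≤ 2 * (R / N / 8)) (hU : U ^ 2 ≤ (R / N + z) ^ 2 + k * (4 * R / N ^ 2)) :
    U ≤ R / N + z + 3 * k / N := by
  have h1 : 3 / 4 * (R / N) ≤ R / N + z := by linarith [(abs_le.1 hz).1]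
  have h2 : 0 < R / N := by positivity
  have h3 : k * (4 * R / N ^ 2) ≤ 2 * (R / N + z) * (3 * k / N) := by
    calc k * (4 * R / N ^ 2) = 2 * (2 / 3 * (R / N)) * (3 * k / N) := by field_simp; ring
      _ ≤ _ := by
        gcongr
        linarith
  refine le_of_sq_le_sq ?_ (add_nonneg (by linarith) (by positivity))
  nlinarith [sq_nonneg (3 * k / N)]

/-- The box has volume at least V/4, V = R^{(k+2)/2} N^{-(k+1)}. There are n+1 density factors but
only n volumes; the prefactor R^{-(k+2)/2} makes up for the missing V. -/
theorem rpow_mul_pow_le_box_product {c γ δ R : ℝ} {k : ℕ} (hc : 0 < c) (hR : 1 ≤ R) (n : ℕ) :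
    R ^ (-(((k : ℝ) + 2) / 2)) * ((c / 4 * R ^ (((k : ℝ) + 2) / 2 - γ)) ^ (n + 1) *
      ((n : ℝ) + 1) ^ (-(((k : ℝ) + 1 - δ) * ((n : ℝ) + 1)))) ≤
    (c * R ^ (-γ) * ((n : ℝ) + 1) ^ δ) ^ (n + 1) *
      (2 * (R / ((n : ℝ) + 1) / 8) * (2 * (√R / ((n : ℝ) + 1))) ^ k) ^ n := by
  set N : ℝ := (n : ℝ) + 1 with hN
  have hN1 : 1 ≤ N := by rw [hN]; linarith [Nat.cast_nonneg (α := ℝ) n]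
  have hN0 : 0 < N := by linarith
  have hR0 : 0 < R := by linarith
  have hNc : ((n + 1 : ℕ) : ℝ) = N := by push_cast; rfl
  set p := ((k : ℝ) + 2) / 2 with hp
  have e1 : R ^ p = R * √R ^ k := by
    rw [Real.sqrt_eq_rpow, ← Real.rpow_natCast, ← Real.rpow_mul hR0.le, ← Real.rpow_one_add' hR0.le
      (by positivity)]
    congr 1
    rw [hp]; ring
  have e2 : N ^ ((k : ℝ) + 1) = N * N ^ k := by
    rw [Real.rpow_add_one hN0.ne', Real.rpow_natCast, mul_comm]
  set V := R ^ p * (N ^ ((k : ℝ) + 1))⁻¹ with hV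
  have hV0 : 0 < V := by positivity
  have h1 : V / 4 ≤ 2 * (R / N / 8) * (2 * (√R / N)) ^ k := by
    have : 2 * (R / N / 8) * (2 * (√R / N)) ^ k = V / 4 * 2 ^ k := by
      rw [hV, e1, e2, mul_pow, div_pow]
      field_simp
      ring
    rw [this]
    exact le_mul_of_one_le_right (by positivity) (one_le_pow₀ one_le_two)
  have e3 : R ^ (p - γ) * N ^ (-((k : ℝ) + 1 - δ)) = R ^ (-γ) * N ^ δ * V := by
    rw [hV, ← Real.rpow_neg hN0.le, sub_eq_add_neg, Real.rpow_add hR0,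
      show -((k : ℝ) + 1 - δ) = δ + -((k : ℝ) + 1) by ring, Real.rpow_add hN0]
    ring
  have e4 : N ^ (-(((k : ℝ) + 1 - δ) * N)) = (N ^ (-((k : ℝ) + 1 - δ))) ^ (n + 1) := by
    rw [← Real.rpow_natCast _ (n + 1), ← Real.rpow_mul hN0.le, hNc, neg_mul]
  calc R ^ (-p) * ((c / 4 * R ^ (p - γ)) ^ (n + 1) * N ^ (-(((k : ℝ) + 1 - δ) * N)))
      = R ^ (-p) * (c / 4) ^ (n + 1) * (R ^ (p - γ) * N ^ (-((k : ℝ) + 1 - δ))) ^ (n + 1) := by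
        rw [e4, mul_pow, mul_pow]; ring
    _ = (c * R ^ (-γ) * N ^ δ) ^ (n + 1) * (V / 4) ^ n * (R ^ (-p) * V / 4) := by
        rw [e3]
        simp only [div_pow, mul_pow]
        ring
    _ ≤ (c * R ^ (-γ) * N ^ δ) ^ (n + 1) * (V / 4) ^ n * 1 := by
        refine mul_le_mul_of_nonneg_left ?_ (by positivity)
        have : R ^ (-p) * V = (N ^ ((k : ℝ) + 1))⁻¹ := by
          rw [hV, ← mul_assoc, ← Real.rpow_add hR0]; simp
        rw [this]
        have : (N ^ ((k : ℝ) + 1))⁻¹ ≤ 1 := inv_le_one_of_one_le₀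
          (Real.one_le_rpow hN1 (by positivity))
        linarith
    _ ≤ _ := by rw [mul_one]; gcongr

theorem exists_le_convPow {d : ℕ} (hd : 1 ≤ d) {m γ δ : ℝ} (hm : 0 < m) (hγ₀ : 0 ≤ γ)
    {g : ℝ → ℝ≥0∞} (hg : ProfileLowerBound g γ δ) :
    ∃ c : ℝ, 0 < c ∧ c ≤ 1 ∧ ∀ (n : ℕ) (x : EuclideanSpace ℝ (Fin d)), 1 ≤ ‖x‖ →
      ENNReal.ofReal (Real.exp (-m * ‖x‖) * ‖x‖ ^ (-(((d : ℝ) + 1) / 2)) *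
        ((c * ‖x‖ ^ (((d : ℝ) + 1) / 2 - γ)) ^ (n + 1) *
          ((n : ℝ) + 1) ^ (-((d - δ) * ((n : ℝ) + 1))))) ≤
        convPow (expDensity m g) n x := by
  obtain ⟨k, rfl⟩ : ∃ k, d = k + 1 := ⟨d - 1, by omega⟩
  have hcast : (((k + 1 : ℕ) : ℝ) + 1) / 2 = ((k : ℝ) + 2) / 2 := by push_cast; ring
  rw [hcast]
  set L : ℝ := 2 + 3 * k with hL
  have hL1 : 1 ≤ L := by rw [hL]; linarith [Nat.cast_nonneg (α := ℝ) k]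
  -- The exponential pays, at each step, for an excess length of at most 3k; L bounds the step
  -- length in units of R/N.
  set c := Real.exp (-(3 * k * m)) * L ^ (-γ) with hc
  have hc0 : 0 < c := by positivity
  have hc1 : c ≤ 1 := mul_le_one₀ (Real.exp_le_one_iff.2 (by simp; positivity)) (by positivity)
    (Real.rpow_le_one_of_one_le_of_nonpos hL1 (by linarith))
  refine ⟨c / 4, by positivity, by linarith, fun n x hx ↦ ?_⟩
  set R := ‖x‖ with hR
  set N : ℝ := (n : ℝ) + 1 with hN
  have hR0 : 0 < R := by linarith
  have hN1 : 1 ≤ N := by rw [hN]; linarith [Nat.cast_nonneg (α := ℝ) n]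
  have hN0 : 0 < N := by linarith
  set e := R⁻¹ • x with he
  have he1 : ‖e‖ = 1 := by
    rw [he, norm_smul, norm_inv, norm_norm, inv_mul_cancel₀ hR0.ne']
  have hex : inner ℝ (m • e) x = m * R := by
    rw [real_inner_smul_left, he, real_inner_smul_left, real_inner_self_eq_norm_sq, ← hR]
    field_simp
  obtain ⟨B, hBm, hB0, hBv, hB⟩ := exists_box he1 (a := R / N / 8) (t := √R / N) (by positivity)
    (by positivity)
  have hκ : ∀ w ∈ B, ∀ w' ∈ B, ENNReal.ofReal (c * R ^ (-γ) * N ^ δ) ≤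
      expTilt (m • e) (expDensity m g) ((R / N) • e + (w - w')) := by
    intro w hw w' hw'
    obtain ⟨h1, h2⟩ := hB w hw w' hw'
    set z := w - w' with hz
    set u := (R / N) • e + z with hu
    have hτ : inner ℝ e u = R / N + inner ℝ e z := by
      rw [hu, inner_add_right, real_inner_smul_right, real_inner_self_eq_norm_sq, he1]; ring
    have hU : ‖u‖ ^ 2 ≤ (R / N + inner ℝ e z) ^ 2 + k * (4 * R / N ^ 2) := by
      have h3 : ‖u‖ ^ 2 = (R / N) ^ 2 + 2 * (R / N) * inner ℝ e z + ‖z‖ ^ 2 := by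
        rw [hu, norm_add_sq_real, norm_smul, he1, real_inner_smul_left, Real.norm_eq_abs, mul_one,
          sq_abs]
        ring
      have h4 : (2 * (√R / N)) ^ 2 = 4 * R / N ^ 2 := by
        rw [mul_pow, div_pow, Real.sq_sqrt hR0.le]; ring
      rw [h4] at h2
      rw [h3]
      nlinarith
    have hUle := le_add_div_of_sq_le (Nat.cast_nonneg k) hR0 hN0 h1 hU
    have hs0 : 0 < R / N := by positivity
    have hτ0 : 0 < inner ℝ e u := by rw [hτ]; linarith [(abs_le.1 h1).1]
    have hu0 : 0 < ‖u‖ := norm_pos_iff.2 fun h ↦ by simp [h] at hτ0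
    have h5 : 3 * (k : ℝ) / N ≤ 3 * k := div_le_self (by positivity) hN1
    have h6 : 3 * (k : ℝ) / N ≤ 3 * k * (R / N) := by
      rw [mul_div_assoc', div_le_div_iff_of_pos_right hN0]
      exact le_mul_of_one_le_right (by positivity) hx
    have hgu := hg L ‖u‖ R N hL1 hu0 hx hN1 (by rw [hL]; linarith [(abs_le.1 h1).2])
    rw [expTilt, expDensity, ← mul_assoc, ← ENNReal.ofReal_mul (by positivity), ← Real.exp_add]
    refine le_trans ?_ (mul_le_mul_right hgu _)
    rw [← ENNReal.ofReal_mul (by positivity)]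
    refine ENNReal.ofReal_le_ofReal ?_
    rw [hc, mul_assoc, mul_assoc, mul_assoc, ← mul_assoc (L ^ (-γ))]
    refine mul_le_mul_of_nonneg_right (Real.exp_le_exp.2 ?_) (by positivity)
    rw [real_inner_smul_left, hτ]
    nlinarith
  have hF := le_convPow_of_forall_le hBm hB0 hκ n 0 hB0
  have hxe : ((n : ℝ) + 1) • (R / N) • e + 0 = x := by
    rw [add_zero, he, smul_smul, smul_smul, ← hN]
    rw [show N * (R / N) * R⁻¹ = 1 by field_simp, one_smul]
  rw [hxe, hBv, ← ENNReal.ofReal_pow (by positivity), ← ENNReal.ofReal_pow (by positivity),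
    ← ENNReal.ofReal_mul (by positivity)] at hF
  rw [convPow_eq_mul_convPow_expTilt (m • e) n x, hex]
  refine le_trans ?_ (mul_le_mul_right hF _)
  rw [← ENNReal.ofReal_mul (by positivity), mul_assoc, ← neg_mul m R]
  refine ENNReal.ofReal_le_ofReal (mul_le_mul_of_nonneg_left ?_ (Real.exp_pos _).le)
  push_cast
  exact rpow_mul_pow_le_box_product hc0 hx n

end LowerBound

/-! ### Common properties of the two profiles and comparison constants. -/

section Profile

/-- The properties shared by the two profiles, which differ only in the exponent `δ`. -/
structure PowerLikeProfile (g : ℝ → ℝ≥0∞) (γ δ : ℝ) : Prop where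
  measurable : Measurable g
  le_powerProfile : ∀ r, g r ≤ powerProfile γ r
  ne_zero : ∀ r, g r ≠ 0
  lower : ProfileLowerBound g γ δ
  doubling : ∀ r r', r' ≤ 2 * r → g r ≤ ENNReal.ofReal (2 ^ γ) * g r'
  eq_of_one_le : ∀ r, 1 ≤ r → g r = ENNReal.ofReal (r ^ (-γ))

theorem ENNReal.rpow_neg_le_rpow_neg {a b : ℝ≥0∞} {γ : ℝ} (hγ : 0 ≤ γ) (h : a ≤ b) :
    b ^ (-γ) ≤ a ^ (-γ) := by
  rw [ENNReal.rpow_neg, ENNReal.rpow_neg]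
  exact ENNReal.inv_le_inv.2 (ENNReal.rpow_le_rpow h hγ)

theorem ENNReal.rpow_neg_le_two_rpow_mul {a b : ℝ≥0∞} {γ : ℝ} (hγ : 0 ≤ γ) (h : b ≤ 2 * a) :
    a ^ (-γ) ≤ ENNReal.ofReal (2 ^ γ) * b ^ (-γ) := by
  have h2 : ENNReal.ofReal (2 ^ γ) = (2 : ℝ≥0∞) ^ γ := by
    rw [← ENNReal.ofReal_rpow_of_pos two_pos]; simp
  have h0 : (2 : ℝ≥0∞) ^ γ ≠ 0 := by simp [ENNReal.rpow_eq_zero_iff]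
  have ht : (2 : ℝ≥0∞) ^ γ ≠ ∞ := ENNReal.rpow_ne_top_of_nonneg hγ (by simp)
  have h1 := ENNReal.rpow_neg_le_rpow_neg hγ h
  rw [ENNReal.rpow_neg (2 * a), ENNReal.mul_rpow_of_nonneg _ _ hγ,
    ENNReal.mul_inv (Or.inl h0) (Or.inl ht), ← ENNReal.rpow_neg] at h1
  calc a ^ (-γ) = 2 ^ γ * ((2 ^ γ)⁻¹ * a ^ (-γ)) := by
        rw [← mul_assoc, ENNReal.mul_inv_cancel h0 ht, one_mul]
    _ ≤ _ := by rw [h2]; gcongr; rwa [ENNReal.rpow_neg a, ← ENNReal.rpow_neg 2]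

theorem ENNReal.ofReal_rpow_neg_ne_zero {γ r : ℝ} (hγ : 0 ≤ γ) :
    ENNReal.ofReal r ^ (-γ) ≠ 0 := by
  rw [Ne, ENNReal.rpow_eq_zero_iff]
  rintro (⟨-, h⟩ | ⟨h, -⟩)
  · linarith
  · exact ENNReal.ofReal_ne_top h

theorem powerLikeProfile_powerProfile {γ : ℝ} (hγ : 0 ≤ γ) :
    PowerLikeProfile (powerProfile γ) γ γ where
  measurable := by unfold powerProfile; fun_prop
  le_powerProfile _ := le_rfl
  ne_zero _ := ENNReal.ofReal_rpow_neg_ne_zero hγ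
  lower := profileLowerBound_powerProfile hγ
  doubling r r' h := by
    refine ENNReal.rpow_neg_le_two_rpow_mul hγ ?_
    rw [← ENNReal.ofReal_ofNat 2, ← ENNReal.ofReal_mul zero_le_two]
    exact ENNReal.ofReal_le_ofReal h
  eq_of_one_le r hr := powerProfile_of_pos (by linarith)

theorem powerLikeProfile_truncatedPowerProfile {γ : ℝ} (hγ : 0 ≤ γ) :
    PowerLikeProfile (truncatedPowerProfile γ) γ 0 where
  measurable := by unfold truncatedPowerProfile; fun_prop
  le_powerProfile r := ENNReal.rpow_neg_le_rpow_neg hγ (ENNReal.ofReal_le_ofReal (le_max_right _ _))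
  ne_zero _ := ENNReal.ofReal_rpow_neg_ne_zero hγ
  lower := profileLowerBound_truncatedPowerProfile hγ
  doubling r r' h := by
    refine ENNReal.rpow_neg_le_two_rpow_mul hγ ?_
    rw [← ENNReal.ofReal_ofNat 2, ← ENNReal.ofReal_mul zero_le_two]
    refine ENNReal.ofReal_le_ofReal (max_le ?_ (h.trans ?_))
    · linarith [le_max_left 1 r]
    · linarith [le_max_right 1 r]
  eq_of_one_le r hr := by rw [truncatedPowerProfile_eq, max_eq_right hr]

variable {d : ℕ} {m γ δ : ℝ} {g : ℝ → ℝ≥0∞}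

namespace PowerLikeProfile

theorem measurable_expDensity (hg : PowerLikeProfile g γ δ) :
    Measurable (expDensity m g : EuclideanSpace ℝ (Fin d) → ℝ≥0∞) := by
  have := hg.measurable
  unfold expDensity
  fun_prop

theorem expDensity_le (hg : PowerLikeProfile g γ δ) (x : EuclideanSpace ℝ (Fin d)) :
    expDensity m g x ≤ expDensity m (powerProfile γ) x :=
  mul_le_mul_right (hg.le_powerProfile _) _

theorem expDensity_eq (hg : PowerLikeProfile g γ δ) {x : EuclideanSpace ℝ (Fin d)}
    (hx : 1 ≤ ‖x‖) : expDensity m g x = ENNReal.ofReal (Real.exp (-m * ‖x‖) * ‖x‖ ^ (-γ)) := by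
  rw [expDensity, hg.eq_of_one_le _ hx, ← ENNReal.ofReal_mul (by positivity)]

theorem lintegral_ne_top (hg : PowerLikeProfile g γ δ) (hd : 1 ≤ d) (hm : 0 < m) (hγ : γ < d) :
    ∫⁻ x : EuclideanSpace ℝ (Fin d), expDensity m g x ≠ ∞ := by
  have : Nontrivial (EuclideanSpace ℝ (Fin d)) := by
    have : Nonempty (Fin d) := ⟨⟨0, hd⟩⟩
    exact inferInstance
  have hne : ∀ᵐ y : EuclideanSpace ℝ (Fin d), y ≠ 0 := by
    simp [ae_iff]
  refine ne_top_of_le_ne_top (lintegral_exp_neg_mul_norm_mul_rpow_ne_top hd hm hγ)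
    (lintegral_mono_ae ?_)
  filter_upwards [hne] with y hy
  refine (hg.expDensity_le y).trans_eq ?_
  rw [expDensity, powerProfile_of_pos (norm_pos_iff.2 hy), ← ENNReal.ofReal_mul (by positivity)]

theorem l1Norm_pos (hg : PowerLikeProfile g γ δ) (hd : 1 ≤ d) (hm : 0 < m) (hγ : γ < d) :
    0 < l1Norm (expDensity m g : EuclideanSpace ℝ (Fin d) → ℝ≥0∞) := by
  refine ENNReal.toReal_pos (fun h ↦ ?_) (hg.lintegral_ne_top hd hm hγ)
  rw [lintegral_eq_zero_iff hg.measurable_expDensity] at h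
  obtain ⟨x, hx⟩ := h.exists
  have := mul_eq_zero.1 hx
  rcases this with h | h
  · exact absurd h (ENNReal.ofReal_pos.2 (Real.exp_pos _)).ne'
  · exact hg.ne_zero _ h

/-- Both comparison conditions are instances of this one; for ‖x‖ ≤ 1, doubling x adds at most 1 to
the norm. -/
theorem expDensity_le_mul (hg : PowerLikeProfile g γ δ) (hm : 0 < m)
    {x y : EuclideanSpace ℝ (Fin d)} (h1 : ‖y‖ ≤ ‖x‖ + 1) (h2 : ‖y‖ ≤ 2 * ‖x‖) :
    expDensity m g x ≤ ENNReal.ofReal (Real.exp m * 2 ^ γ) * expDensity m g y := by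
  rw [expDensity, expDensity, ENNReal.ofReal_mul (Real.exp_pos _).le, mul_mul_mul_comm,
    ← ENNReal.ofReal_mul (Real.exp_pos _).le, ← Real.exp_add]
  refine mul_le_mul' (ENNReal.ofReal_le_ofReal (Real.exp_le_exp.2 ?_)) (hg.doubling _ _ h2)
  nlinarith

theorem comparisonConstants (hg : PowerLikeProfile g γ δ) (hm : 0 < m) (hγ : 0 ≤ γ) :
    ComparisonConstants (expDensity m g : EuclideanSpace ℝ (Fin d) → ℝ≥0∞)
      (Real.exp m * 2 ^ γ) (Real.exp m * 2 ^ γ) := by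
  have h : 1 ≤ Real.exp m * (2 : ℝ) ^ γ :=
    one_le_mul_of_one_le_of_one_le (Real.one_le_exp hm.le) (Real.one_le_rpow one_le_two hγ)
  have hn (x : EuclideanSpace ℝ (Fin d)) : ‖(2 : ℝ) • x‖ = 2 * ‖x‖ := by simp [norm_smul]
  refine ⟨h, h, fun x y hx _ hy ↦ hg.expDensity_le_mul hm hy (by linarith), fun x hx ↦ ?_⟩
  exact hg.expDensity_le_mul hm (by rw [hn]; linarith) (hn x).le

/-- Testing at norms 1 and 2 gives e^{-m} ≤ C₁ e^{-2m} 2^{-γ}. Hence M₂ dominates e^m ‖f‖₁, the rate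
produced by many jumps. -/
theorem exp_le_of_comparisonConstants (hg : PowerLikeProfile g γ δ) (hd : 1 ≤ d) (hγ : 0 ≤ γ)
    {C₁ C₂ : ℝ}
    (h : ComparisonConstants (expDensity m g : EuclideanSpace ℝ (Fin d) → ℝ≥0∞) C₁ C₂) :
    Real.exp m ≤ C₁ := by
  set x : EuclideanSpace ℝ (Fin d) := EuclideanSpace.single ⟨0, hd⟩ 1 with hx
  have hx1 : ‖x‖ = 1 := by simp [hx]
  have hx2 : ‖(2 : ℝ) • x‖ = 2 := by simp [norm_smul, hx1]
  have hC := h.le_of_norm_le x ((2 : ℝ) • x) hx1.ge (by rw [hx1, hx2]; norm_num)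
    (by rw [hx1, hx2]; norm_num)
  have hC0 := h.one_le_left
  rw [hg.expDensity_eq hx1.ge, hg.expDensity_eq (by rw [hx2]; norm_num), hx1, hx2,
    ← ENNReal.ofReal_mul (by linarith), ENNReal.ofReal_le_ofReal_iff (by positivity),
    Real.one_rpow, mul_one, mul_one] at hC
  have h2 : (2 : ℝ) ^ (-γ) ≤ 1 := Real.rpow_le_one_of_one_le_of_nonpos one_le_two (by linarith)
  have h3 : Real.exp (-m) ≤ C₁ * Real.exp (-m * 2) := hC.trans (by
    refine mul_le_mul_of_nonneg_left ?_ (by linarith)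
    exact mul_le_of_le_one_right (Real.exp_pos _).le h2)
  calc Real.exp m = Real.exp (-m) * Real.exp (m * 2) := by rw [← Real.exp_add]; ring_nf
    _ ≤ C₁ * Real.exp (-m * 2) * Real.exp (m * 2) := by gcongr
    _ = C₁ := by rw [mul_assoc, ← Real.exp_add]; simp

end PowerLikeProfile

end Profile

/-! ### Two-sided bounds for the compound Poisson series. -/

section CompoundPoisson

variable {d : ℕ} {m γ δ : ℝ} {g : ℝ → ℝ≥0∞}

/-- The series `∑_{n ≥ 1} λ ^ n f^{n⋆}(x) / n!`, indexed by `n - 1`. -/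
noncomputable def convSeries (f : EuclideanSpace ℝ (Fin d) → ℝ≥0∞) (lam : ℝ)
    (x : EuclideanSpace ℝ (Fin d)) : ℝ≥0∞ :=
  ∑' n : ℕ, ENNReal.ofReal (lam ^ (n + 1) / ((n + 1).factorial : ℝ)) * convPow f n x

theorem ofReal_le_compoundPoissonDensity_div {f : EuclideanSpace ℝ (Fin d) → ℝ≥0∞} {lam Z E : ℝ}
    {x : EuclideanSpace ℝ (Fin d)} (hZ : 0 < Z) (h : ENNReal.ofReal (Z * E) ≤ convSeries f lam x) :
    ENNReal.ofReal E ≤ compoundPoissonDensity f lam x /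
      ENNReal.ofReal (Real.exp (-lam * l1Norm f) * Z) := by
  rw [ENNReal.le_div_iff_mul_le (Or.inl (ENNReal.ofReal_pos.2 (by positivity)).ne')
    (Or.inl ENNReal.ofReal_ne_top), ENNReal.ofReal_mul (Real.exp_pos _).le, mul_left_comm,
    mul_comm (ENNReal.ofReal E), ← ENNReal.ofReal_mul hZ.le]
  exact mul_le_mul_right h _

theorem compoundPoissonDensity_div_le_ofReal {f : EuclideanSpace ℝ (Fin d) → ℝ≥0∞} {lam Z E : ℝ}
    {x : EuclideanSpace ℝ (Fin d)} (hZ : 0 < Z) (h : convSeries f lam x ≤ ENNReal.ofReal (Z * E)) :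
    compoundPoissonDensity f lam x / ENNReal.ofReal (Real.exp (-lam * l1Norm f) * Z) ≤
      ENNReal.ofReal E := by
  rw [ENNReal.div_le_iff (ENNReal.ofReal_pos.2 (by positivity)).ne' ENNReal.ofReal_ne_top,
    ENNReal.ofReal_mul (Real.exp_pos _).le, mul_left_comm, mul_comm (ENNReal.ofReal E),
    ← ENNReal.ofReal_mul hZ.le]
  exact mul_le_mul_right h _

namespace PowerLikeProfile

theorem exists_convPow_le (hg : PowerLikeProfile g γ δ) (hd : 1 ≤ d) (hm : 0 < m) (hγ₀ : 0 ≤ γ)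
    (hγ : γ < ((d : ℝ) + 1) / 2) (hγd : γ < d) :
    ∃ A D : ℝ, 1 ≤ A ∧ 0 < D ∧ ∀ (n : ℕ) (x : EuclideanSpace ℝ (Fin d)), 1 ≤ ‖x‖ →
      convPow (expDensity m g) n x ≤
        ENNReal.ofReal (Real.exp (-m * ‖x‖) * ‖x‖ ^ (-(((d : ℝ) + 1) / 2)) *
          ((A * ‖x‖ ^ (((d : ℝ) + 1) / 2 - γ)) ^ (n + 1) *
              ((n : ℝ) + 1) ^ (-((((d : ℝ) + 1) / 2 - γ) * ((n : ℝ) + 1))) +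
            D * (Real.exp m *
              l1Norm (expDensity m g : EuclideanSpace ℝ (Fin d) → ℝ≥0∞)) ^ (n + 1))) := by
  obtain ⟨A, hA, h1⟩ := exists_convPow_le_of_le_two_mul_norm hd hm hγ₀ hγ
    (hg.measurable_expDensity (m := m)) hg.expDensity_le
  obtain ⟨D, hD, h2⟩ := exists_convPow_le_of_two_mul_norm_le hm hγ₀
    (hg.measurable_expDensity (m := m)) hg.expDensity_le (hg.lintegral_ne_top hd hm hγd)
    (hg.l1Norm_pos hd hm hγd) (p := ((d : ℝ) + 1) / 2) (by positivity)
  have hI := hg.l1Norm_pos hd hm hγd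
  refine ⟨A, D, hA, hD, fun n x hx ↦ ?_⟩
  rcases le_total ((n : ℝ) + 1) (2 * ‖x‖) with h | h
  · refine (h1 n x hx h).trans (ENNReal.ofReal_le_ofReal ?_)
    gcongr
    exact le_add_of_nonneg_right (by positivity)
  · refine (h2 n x hx h).trans (ENNReal.ofReal_le_ofReal ?_)
    gcongr
    exact le_add_of_nonneg_left (by positivity)

/-- As R ≥ 1, λ ≤ u ≤ 1, so all powers of u and of λ are at most u; this factors out and leaves
exponentials of constants. -/
theorem exists_convSeries_le_of_le_one (hg : PowerLikeProfile g γ δ) (hd : 1 ≤ d) (hm : 0 < m)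
    (hγ₀ : 0 ≤ γ) (hγ : γ < ((d : ℝ) + 1) / 2) (hγd : γ < d) :
    ∃ E : ℝ, 0 < E ∧ ∀ (x : EuclideanSpace ℝ (Fin d)) (lam : ℝ), 1 ≤ ‖x‖ → 0 < lam →
      lam * ‖x‖ ^ (((d : ℝ) + 1) / 2 - γ) ≤ 1 →
      convSeries (expDensity m g) lam x ≤
        ENNReal.ofReal (Real.exp (-m * ‖x‖) * ‖x‖ ^ (-(((d : ℝ) + 1) / 2)) *
          (lam * ‖x‖ ^ (((d : ℝ) + 1) / 2 - γ) * E)) := by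
  obtain ⟨A, D, hA, hD, h⟩ := hg.exists_convPow_le hd hm hγ₀ hγ hγd
  have hI := hg.l1Norm_pos hd hm hγd
  set θ := Real.exp m * l1Norm (expDensity m g : EuclideanSpace ℝ (Fin d) → ℝ≥0∞)
  have hθ : 0 < θ := by positivity
  refine ⟨Real.exp A + D * Real.exp θ, by positivity, fun x lam hx hlam hu ↦ ?_⟩
  set β := ((d : ℝ) + 1) / 2 - γ with hβ
  have hβ0 : 0 ≤ β := by linarith
  set u := lam * ‖x‖ ^ β with hu'
  have hu0 : 0 < u := by positivity
  have hlu : lam ≤ u := le_mul_of_one_le_right hlam.le (Real.one_le_rpow hx hβ0)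
  refine (tsum_mul_le_of_forall_le (K₁ := u) (K₂ := u * D) (w₁ := A) (w₂ := θ) hlam (by positivity)
    hu0.le (by positivity) (by linarith) hθ.le (fun n ↦ h n x hx) fun n ↦ ?_).trans_eq ?_
  · have e1 : u ^ (n + 1) ≤ u := pow_le_of_le_one hu0.le hu (by omega)
    have e2 : lam ^ (n + 1) ≤ u := (pow_le_pow_left₀ hlam.le hlu _).trans e1
    have e3 : ((n : ℝ) + 1) ^ (-(β * ((n : ℝ) + 1))) ≤ 1 :=
      Real.rpow_le_one_of_one_le_of_nonpos (by linarith [Nat.cast_nonneg (α := ℝ) n])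
        (by rw [neg_nonpos]; positivity)
    calc _ = u ^ (n + 1) * (A ^ (n + 1) / ((n + 1).factorial : ℝ)) *
          ((n : ℝ) + 1) ^ (-(β * ((n : ℝ) + 1))) +
          lam ^ (n + 1) * D * (θ ^ (n + 1) / ((n + 1).factorial : ℝ)) := by
            rw [hu', mul_pow, mul_pow]; ring
      _ ≤ u * (A ^ (n + 1) / ((n + 1).factorial : ℝ)) * 1 +
          u * D * (θ ^ (n + 1) / ((n + 1).factorial : ℝ)) := by gcongr
      _ = _ := by ring
  · congr 1
    ring

/-- `M` is quantified after the constants so that it can become M₂ for any comparison constants. -/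
theorem exists_convSeries_le (hg : PowerLikeProfile g γ δ) (hd : 1 ≤ d) (hm : 0 < m)
    (hγ₀ : 0 ≤ γ) (hγ : γ < ((d : ℝ) + 1) / 2) (hγd : γ < d) :
    ∃ E E' : ℝ, 0 < E ∧ 0 < E' ∧ ∀ (x : EuclideanSpace ℝ (Fin d)) (lam M : ℝ), 1 ≤ ‖x‖ →
      0 < lam → Real.exp m * l1Norm (expDensity m g : EuclideanSpace ℝ (Fin d) → ℝ≥0∞) ≤ M →
      convSeries (expDensity m g) lam x ≤
        ENNReal.ofReal (Real.exp (-m * ‖x‖) * ‖x‖ ^ (-(((d : ℝ) + 1) / 2)) *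
          (E * Real.exp (lam * M) * Real.exp (E' *
            (lam * ‖x‖ ^ (((d : ℝ) + 1) / 2 - γ)) ^ (1 / (((d : ℝ) + 1) / 2 - γ + 1))))) := by
  obtain ⟨A, D, hA, hD, h⟩ := hg.exists_convPow_le hd hm hγ₀ hγ hγd
  have hI := hg.l1Norm_pos hd hm hγd
  set θ := Real.exp m * l1Norm (expDensity m g : EuclideanSpace ℝ (Fin d) → ℝ≥0∞)
  have hθ : 0 < θ := by positivity
  set β := ((d : ℝ) + 1) / 2 - γ with hβ
  have hβ0 : 0 < β := by linarith
  refine ⟨1 + D, (β + 1) * A ^ (1 / (β + 1)), by positivity, by positivity,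
    fun x lam M hx hlam hM ↦ ?_⟩
  set u := lam * ‖x‖ ^ β with hu
  have hu0 : 0 < u := by positivity
  set w := (A * u) ^ (1 / (β + 1)) with hw
  have hw0 : 0 ≤ w := by positivity
  refine (tsum_mul_le_of_forall_le (K₁ := Real.exp (β * w)) (K₂ := D) (w₁ := w) (w₂ := lam * θ)
    hlam (by positivity) (by positivity) (by positivity) hw0 (by positivity)
    (fun n ↦ h n x hx) fun n ↦ ?_).trans (ENNReal.ofReal_le_ofReal ?_)
  · have e1 := pow_mul_rpow_neg_le (u := A * u) (by positivity) hβ0.le n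
    rw [← hw] at e1
    calc _ = ((A * u) ^ (n + 1) * ((n : ℝ) + 1) ^ (-(β * ((n : ℝ) + 1)))) /
          ((n + 1).factorial : ℝ) + D * ((lam * θ) ^ (n + 1) / ((n + 1).factorial : ℝ)) := by
            rw [hu, mul_pow, mul_pow, mul_pow, mul_pow]; ring
      _ ≤ (Real.exp (β * w) * w ^ (n + 1)) / ((n + 1).factorial : ℝ) +
          D * ((lam * θ) ^ (n + 1) / ((n + 1).factorial : ℝ)) := by gcongr
      _ = _ := by ring
  · refine mul_le_mul_of_nonneg_left ?_ (by positivity)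
    -- The βw comes from the termwise bound, the other w from summing w^{n+1}/(n+1)!.
    have e2 : (β + 1) * A ^ (1 / (β + 1)) * u ^ (1 / (β + 1)) = β * w + w := by
      rw [hw, Real.mul_rpow (x := A) (y := u) (by positivity) hu0.le]; ring
    rw [e2, ← Real.exp_add]
    have e3 : 1 ≤ Real.exp (β * w + w) := Real.one_le_exp (by positivity)
    have e4 : Real.exp (lam * θ) ≤ Real.exp (lam * M) := by gcongr
    have e5 : 1 ≤ Real.exp (lam * M) := (Real.one_le_exp (by positivity)).trans e4
    calc _ ≤ 1 * Real.exp (β * w + w) + D * Real.exp (lam * M) * 1 := by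
          rw [one_mul, mul_one]; gcongr
      _ ≤ Real.exp (lam * M) * Real.exp (β * w + w) +
          D * Real.exp (lam * M) * Real.exp (β * w + w) := by gcongr
      _ = _ := by ring

theorem le_convSeries (hg : PowerLikeProfile g γ δ) {x : EuclideanSpace ℝ (Fin d)} {lam : ℝ}
    (hx : 1 ≤ ‖x‖) (hlam : 0 < lam) :
    ENNReal.ofReal (lam * (Real.exp (-m * ‖x‖) * ‖x‖ ^ (-γ))) ≤
      convSeries (expDensity m g) lam x := by
  refine le_trans (le_of_eq ?_) (ENNReal.le_tsum 0)
  simp [convPow, hg.expDensity_eq hx, ENNReal.ofReal_mul hlam.le]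

theorem exists_le_convSeries (hg : PowerLikeProfile g γ δ) (hd : 1 ≤ d) (hm : 0 < m)
    (hγ₀ : 0 ≤ γ) (hδ : δ < d) :
    ∃ E E' : ℝ, 0 < E ∧ 0 < E' ∧ ∀ (x : EuclideanSpace ℝ (Fin d)) (lam : ℝ), 1 ≤ ‖x‖ →
      0 < lam → 1 ≤ lam * ‖x‖ ^ (((d : ℝ) + 1) / 2 - γ) →
      ENNReal.ofReal (Real.exp (-m * ‖x‖) * ‖x‖ ^ (-(((d : ℝ) + 1) / 2)) *
          (E * Real.exp (E' *
            (lam * ‖x‖ ^ (((d : ℝ) + 1) / 2 - γ)) ^ (1 / (d - δ + 1))))) ≤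
        convSeries (expDensity m g) lam x := by
  obtain ⟨c, hc0, hc1, h⟩ := exists_le_convPow hd hm hγ₀ hg.lower
  refine ⟨c * Real.exp (-1), (c * Real.exp (-1)) ^ (1 / (d - δ + 1)), by positivity, by positivity,
    fun x lam hx hlam hu ↦ ?_⟩
  obtain ⟨n, hn⟩ := exists_mul_exp_le_pow_div_factorial (ρ := d - δ) hc0 hc1 hu (by linarith)
  refine le_trans ?_ (ENNReal.le_tsum n)
  refine le_trans ?_ (mul_le_mul_right (h n x hx) _)
  rw [← ENNReal.ofReal_mul (by positivity)]
  refine ENNReal.ofReal_le_ofReal ((mul_le_mul_of_nonneg_left hn (by positivity)).trans_eq ?_)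
  rw [mul_left_comm c lam, mul_pow lam]
  ring

end PowerLikeProfile

end CompoundPoisson

/-! ### The main theorem. -/

theorem corollary4p11 (d : ℕ) (hd : 1 ≤ d) (m γ : ℝ) (hm : 0 < m)
    (hγ₀ : 0 ≤ γ) (hγ : γ < ((d : ℝ) + 1) / 2)
    (g : ℝ → ℝ≥0∞) (ρ₁ ρ₂ : ℝ)
    (hg : (g = powerProfile γ ∧ ρ₁ = (d : ℝ) - γ) ∨ (g = truncatedPowerProfile γ ∧ ρ₁ = (d : ℝ)))
    (hρ₂ : ρ₂ = ((d : ℝ) + 1) / 2 - γ)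
    (f : EuclideanSpace ℝ (Fin d) → ℝ≥0∞) (hf : f = expDensity m g) :
    (∫⁻ x, f x) ≠ ∞ ∧
    (∃ C₁ C₂ : ℝ, ComparisonConstants f C₁ C₂) ∧
    ∃ E₁ E₂ E₃ E₄ E₅ E₆ : ℝ, 0 < E₁ ∧ 0 < E₂ ∧ 0 < E₃ ∧ 0 < E₄ ∧ 0 < E₅ ∧ 0 < E₆ ∧
      ∀ (x : EuclideanSpace ℝ (Fin d)) (lam : ℝ), 1 ≤ ‖x‖ → 0 < lam →
        (lam * ‖x‖ ^ (((d : ℝ) + 1) / 2 - γ) ≤ 1 →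
          ENNReal.ofReal E₁ ≤
            compoundPoissonDensity f lam x /
              ENNReal.ofReal
                (lam * Real.exp (-lam * l1Norm f) * Real.exp (-m * ‖x‖) * ‖x‖ ^ (-γ)) ∧
          compoundPoissonDensity f lam x /
              ENNReal.ofReal
                (lam * Real.exp (-lam * l1Norm f) * Real.exp (-m * ‖x‖) * ‖x‖ ^ (-γ)) ≤
            ENNReal.ofReal E₂) ∧
        (1 ≤ lam * ‖x‖ ^ (((d : ℝ) + 1) / 2 - γ) →
          ENNReal.ofReal
              (E₃ * Real.exp (E₄ * (lam * ‖x‖ ^ (((d : ℝ) + 1) / 2 - γ)) ^ (1 / (ρ₁ + 1)))) ≤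
            compoundPoissonDensity f lam x /
              ENNReal.ofReal
                (Real.exp (-lam * l1Norm f) * Real.exp (-m * ‖x‖) *
                  ‖x‖ ^ (-(((d : ℝ) + 1) / 2))) ∧
          ∀ C₁ C₂ : ℝ, ComparisonConstants f C₁ C₂ →
            compoundPoissonDensity f lam x /
                ENNReal.ofReal
                  (Real.exp (-lam * l1Norm f) * Real.exp (-m * ‖x‖) *
                    ‖x‖ ^ (-(((d : ℝ) + 1) / 2))) ≤
              ENNReal.ofReal
                (E₅ * Real.exp (lam * doublingConst f C₁ C₂) *
                  Real.exp
                    (E₆ * (lam * ‖x‖ ^ (((d : ℝ) + 1) / 2 - γ)) ^ (1 / (ρ₂ + 1))))) := by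

  obtain ⟨δ, hgδ, hρ₁, hδ⟩ : ∃ δ, PowerLikeProfile g γ δ ∧ ρ₁ = d - δ ∧ (δ = γ ∨ δ = 0) := by
    rcases hg with ⟨rfl, h⟩ | ⟨rfl, h⟩
    · exact ⟨γ, powerLikeProfile_powerProfile hγ₀, h, Or.inl rfl⟩
    · exact ⟨0, powerLikeProfile_truncatedPowerProfile hγ₀, by rw [h, sub_zero], Or.inr rfl⟩
  have hd1 : (1 : ℝ) ≤ d := by exact_mod_cast hd
  -- Integrability at the origin holds because (d+1)/2 ≤ d when d ≥ 1.
  have hγd : γ < d := by linarith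
  have hδd : δ < d := by rcases hδ with rfl | rfl <;> linarith
  subst hf hρ₁ hρ₂
  obtain ⟨E₂, hE₂, h₂⟩ := hgδ.exists_convSeries_le_of_le_one hd hm hγ₀ hγ hγd
  obtain ⟨E₃, E₄, hE₃, hE₄, h₃⟩ := hgδ.exists_le_convSeries hd hm hγ₀ hδd
  obtain ⟨E₅, E₆, hE₅, hE₆, h₅⟩ := hgδ.exists_convSeries_le hd hm hγ₀ hγ hγd
  refine ⟨hgδ.lintegral_ne_top hd hm hγd, ⟨_, _, hgδ.comparisonConstants hm hγ₀⟩,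
    1, E₂, E₃, E₄, E₅, E₆, one_pos, hE₂, hE₃, hE₄, hE₅, hE₆, fun x lam hx hlam ↦ ?_⟩
  have hx0 : 0 < ‖x‖ := by linarith
  refine ⟨fun hu ↦ ?_, fun hu ↦ ?_⟩
  · have hden : lam * Real.exp (-lam * l1Norm (expDensity m g : EuclideanSpace ℝ (Fin d) → ℝ≥0∞)) *
        Real.exp (-m * ‖x‖) * ‖x‖ ^ (-γ) =
        Real.exp (-lam * l1Norm (expDensity m g : EuclideanSpace ℝ (Fin d) → ℝ≥0∞)) *
          (lam * (Real.exp (-m * ‖x‖) * ‖x‖ ^ (-γ))) := by ring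
    rw [hden]
    refine ⟨ofReal_le_compoundPoissonDensity_div (by positivity) ?_,
      compoundPoissonDensity_div_le_ofReal (by positivity) ((h₂ x lam hx hlam hu).trans_eq ?_)⟩
    · rw [mul_one]
      exact hgδ.le_convSeries hx hlam
    -- That is, λR^{-γ} = R^{-p}u, which matches the two normalisations.
    · have e : ‖x‖ ^ (-γ) = ‖x‖ ^ (-(((d : ℝ) + 1) / 2)) * ‖x‖ ^ (((d : ℝ) + 1) / 2 - γ) := by
        rw [← Real.rpow_add hx0]
        congr 1
        ring
      rw [e]
      congr 1
      ring
  · rw [mul_assoc (Real.exp (-lam * _))]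
    refine ⟨ofReal_le_compoundPoissonDensity_div (by positivity) (h₃ x lam hx hlam hu),
      fun C₁ C₂ hC ↦ compoundPoissonDensity_div_le_ofReal (by positivity)
        (h₅ x lam _ hx hlam ?_)⟩
    exact mul_le_mul_of_nonneg_right ((hgδ.exp_le_of_comparisonConstants hd hγ₀ hC).trans
      (le_max_left _ _)) ENNReal.toReal_nonneg
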